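/- Let $\Bbbk$ be a field (not necessarily algebraically closed) with $\operatorname{char}\Bbbk\neq 2$, and let $n\ge 10$. Let $X_{3,2,n}\subseteq(\mathbb P^3_{\Bbbk})^n$ be the closed subscheme whose $\Bbbk$-rational points are the $n$-tuples $\mathbf p=(p_1,\dots,p_n)$ of points of $\mathbb P^3(\Bbbk)$ (not necessarily distinct) lying on a common quadric surface defined over $\Bbbk$, with the scheme structure given by the vanishing of the $10\times 10$ minors of the $10\times n$ multi-Veronese matrix, whose $i$-th column consists of the values at the $i$-th point of all monomials of degree $2$ in the homogeneous coordinates of $\mathbb P^3$. Here a quadric is the zero scheme of a nonzero quadratic form over $\Bbbk$ (considered up to a nonzero scalar), and $S^{\mathrm{sing}}$ denotes the singular locus of a quadric $S$, given by the vanishing of its form and of all its partial derivatives. A $\Bbbk$-rational point $\mathbf p\in X_{3,2,n}$ is a smooth point of $X_{3,2,n}$ over $\Bbbk$ if and only if there exists a unique quadric $S\subseteq\mathbb P^3$ containing all the points $p_1,\dots,p_n$ and one of the following holds: 1. $S$ is smooth over $\Bbbk$; 2. $S$ is a quadric cone (the cone over a smooth plane conic) and there is at most one index $i$ such that $p_i$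 is the vertex of $S$; 3. $S$ is the union of two distinct planes, there are at most three indices $i$ such that $p_i\in S^{\mathrm{sing}}$ (the line of intersection of the two planes), and the corresponding points $p_i$ are pairwise distinct. -/

import Mathlib

namespace PointConfig

open MvPolynomial

/-- A degree `d` hypersurface of `ℙ^r` over `k`: a nonzero form of degree `d` up to nonzero scalars,
that is, a `k`-point of the linear system `|𝒪(d)|`. -/
abbrev Hypersurface (k : Type*) [Field k] (r d : ℕ) : Type _ :=
  Projectivization k (homogeneousSubmodule (Fin (r + 1)) k d)

namespace Hypersurface

variable {k : Type*} [Field k] {r d : ℕ}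

/-- A defining form of the hypersurface (well defined up to a nonzero scalar). -/
noncomputable def form (S : Hypersurface k r d) : MvPolynomial (Fin (r + 1)) k :=
  (S.rep : homogeneousSubmodule (Fin (r + 1)) k d)

/-- The `k`-rational point `x` lies on `S`. -/
def Contains (S : Hypersurface k r d) (x : Projectivization k (Fin (r + 1) → k)) : Prop :=
  eval x.rep S.form = 0

/-- The `k`-rational point `x` lies in the singular locus of `S`: the form and all its partial
derivatives vanish at `x`. -/
def IsSingularAt (S : Hypersurface k r d) (x : Projectivization k (Fin (r + 1) → k)) : Prop :=
  S.Contains x ∧ ∀ j, eval x.rep (pderiv j S.form) = 0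

end Hypersurface

/-- The projective hypersurface `F = 0` is smooth over `k`: it has no singular point
over an algebraic closure of `k`. -/
def IsSmoothForm {k σ : Type*} [Field k] (F : MvPolynomial σ k) : Prop :=
  ∀ v : σ → AlgebraicClosure k, v ≠ 0 → aeval v F = 0 → ∃ j, aeval v (pderiv j F) ≠ 0

/-- `F = 0` in `ℙ³` is a quadric cone: the cone over a smooth plane conic `G = 0`, i.e.
`F = G(ℓ₀, ℓ₁, ℓ₂)` for linearly independent linear forms `ℓ₀, ℓ₁, ℓ₂`. The vertex is
the point `ℓ₀ = ℓ₁ = ℓ₂ = 0`. -/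
def IsQuadricCone {k : Type*} [Field k] (F : MvPolynomial (Fin 4) k) : Prop :=
  ∃ (G : MvPolynomial (Fin 3) k) (l : Fin 3 → MvPolynomial (Fin 4) k),
    G.IsHomogeneous 2 ∧ IsSmoothForm G ∧ (∀ a, (l a).IsHomogeneous 1) ∧
      LinearIndependent k l ∧ F = aeval l G

/-- `F = 0` is the union of two distinct planes (defined over `k`). -/
def IsTwoPlanes {k : Type*} [Field k] (F : MvPolynomial (Fin 4) k) : Prop :=
  ∃ l₁ l₂ : MvPolynomial (Fin 4) k, l₁.IsHomogeneous 1 ∧ l₂.IsHomogeneous 1 ∧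
    LinearIndependent k ![l₁, l₂] ∧ F = l₁ * l₂

/-- The exponents of the monomials of degree `d` in the `r + 1` homogeneous coordinates. -/
abbrev Mon (r d : ℕ) : Type :=
  {m : Fin (r + 1) →₀ ℕ // m ∈ Finset.finsuppAntidiag (Finset.univ : Finset (Fin (r + 1))) d}

/-- The multi-Veronese matrix: its `i`-th column consists of the values at `x i` of all monomials
of degree `d`. -/
def multiVeronese (r d n : ℕ) {R : Type*} [CommRing R] (x : Fin n → Fin (r + 1) → R) :
    Matrix (Mon r d) (Fin n) R :=
  Matrix.of fun m i => ∏ l, x i l ^ m.1 l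

/-- The maximal minor (of size `b(r,d)`) of the multi-Veronese matrix on the columns `c`. -/
def minor (r d n : ℕ) {R : Type*} [CommRing R] (x : Fin n → Fin (r + 1) → R)
    (c : Mon r d ↪ Fin n) : R :=
  ((multiVeronese r d n x).submatrix id c).det

/-- The set of `k`-rational points of `X_{r,d,n}`: configurations of `n` points of `ℙ^r`
lying on a common hypersurface of degree `d`. -/
def X (k : Type*) [Field k] (r d n : ℕ) : Set (Fin n → Projectivization k (Fin (r + 1) → k)) :=
  {p | ∃ S : Hypersurface k r d, ∀ i, S.Contains (p i)}

/-! The scheme structure. For `J : Fin n → Fin (r + 1)`, the open subscheme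
`U_J = {x_{i, J i} ≠ 0 for all i}` of `(ℙ^r)^n` is the affine space with coordinate ring
`k[x_{i,l}] / (x_{i, J i} - 1)`, the remaining `x_{i,l}` being the coordinates `x_{i,l} / x_{i, J i}`.
These cover `(ℙ^r)^n`, and `X_{r,d,n} ∩ U_J` is cut out by the maximal minors of
the multi-Veronese matrix. -/

/-- The ideal of `k[x_{i,l}]` generated by the `x_{i, J i} - 1` and by the maximal minors of the
multi-Veronese matrix of the generic configuration. -/
noncomputable def chartIdeal (k : Type*) [Field k] (r d n : ℕ) (J : Fin n → Fin (r + 1)) :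
    Ideal (MvPolynomial (Fin n × Fin (r + 1)) k) :=
  Ideal.span (Set.range fun i => MvPolynomial.X (i, J i) - 1) ⊔
    Ideal.span (Set.range (minor r d n fun i l => MvPolynomial.X (i, l)))

/-- The coordinate ring of the affine open subscheme `X_{r,d,n} ∩ U_J` of `X_{r,d,n}`. -/
abbrev ChartRing (k : Type*) [Field k] (r d n : ℕ) (J : Fin n → Fin (r + 1)) : Type _ :=
  MvPolynomial (Fin n × Fin (r + 1)) k ⧸ chartIdeal k r d n J

section Points

variable {k : Type*} [Field k] {r d n : ℕ}

/-- The configuration `p` lies in the open set `U_J`. -/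
def InChart (p : Fin n → Projectivization k (Fin (r + 1) → k)) (J : Fin n → Fin (r + 1)) : Prop :=
  ∀ i, (p i).rep (J i) ≠ 0

/-- The affine coordinates of `p` in the chart `U_J`. -/
noncomputable def chartCoord (p : Fin n → Projectivization k (Fin (r + 1) → k))
    (J : Fin n → Fin (r + 1)) (i : Fin n) (l : Fin (r + 1)) : k :=
  (p i).rep l / (p i).rep (J i)

theorem minor_chartCoord {p : Fin n → Projectivization k (Fin (r + 1) → k)} (hp : p ∈ X k r d n)
    (J : Fin n → Fin (r + 1)) (c : Mon r d ↪ Fin n) : minor r d n (chartCoord p J) c = 0 := by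
  obtain ⟨S, hS⟩ := hp
  have hF : S.form.IsHomogeneous d := (mem_homogeneousSubmodule _ _).1 S.rep.2
  have hne : S.form ≠ 0 := fun h => S.rep_nonzero (Subtype.ext h)
  have hdeg : ∀ m : Fin (r + 1) →₀ ℕ, coeff m S.form ≠ 0 →
      m ∈ Finset.finsuppAntidiag (Finset.univ : Finset (Fin (r + 1))) d := by
    intro m hm
    have h1 := hF hm
    rw [Finset.mem_finsuppAntidiag]
    refine ⟨?_, Finset.subset_univ _⟩
    rw [← h1, Finsupp.weight_apply, Finsupp.sum_fintype _ _ (by simp)]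
    simp
  have heval : ∀ v : Fin (r + 1) → k,
      eval v S.form = ∑ m : Mon r d, coeff m.1 S.form * ∏ l, v l ^ m.1 l := by
    intro v
    rw [eval_eq', Finset.sum_coe_sort (Finset.finsuppAntidiag Finset.univ d)
      (fun m => coeff m S.form * ∏ l, v l ^ m l)]
    refine Finset.sum_subset (fun m hm => hdeg m (mem_support_iff.1 hm)) fun m _ hm => ?_
    rw [notMem_support_iff.1 hm, zero_mul]
  rw [minor, ← Matrix.exists_vecMul_eq_zero_iff]
  refine ⟨fun m => coeff m.1 S.form, fun h => hne ?_, ?_⟩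
  · ext m
    by_contra hm
    exact hm (congrFun h ⟨m, hdeg m hm⟩)
  · funext t
    have h2 : eval (chartCoord p J (c t)) S.form = 0 := by
      have h3 := hS (c t)
      rw [Hypersurface.Contains, heval] at h3
      rw [heval, ← zero_div ((p (c t)).rep (J (c t)) ^ d), ← h3, Finset.sum_div]
      refine Finset.sum_congr rfl fun m _ => ?_
      have hm : ∑ l, m.1 l = d := (Finset.mem_finsuppAntidiag.1 m.2).1
      simp only [chartCoord, div_pow, Finset.prod_div_distrib]
      rw [Finset.prod_pow_eq_pow_sum, hm, mul_div_assoc]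
    rw [heval] at h2
    simpa [Matrix.vecMul, dotProduct, multiVeronese] using h2

/-- Evaluation at `p ∈ X_{r,d,n} ∩ U_J` of the regular functions on `X_{r,d,n} ∩ U_J`. -/
noncomputable def evalAt (p : Fin n → Projectivization k (Fin (r + 1) → k)) (hp : p ∈ X k r d n)
    (J : Fin n → Fin (r + 1)) (hJ : InChart p J) : ChartRing k r d n J →ₐ[k] k :=
  Ideal.Quotient.liftₐ (chartIdeal k r d n J) (aeval fun il => chartCoord p J il.1 il.2) (by
    suffices h : chartIdeal k r d n J ≤
        RingHom.ker (aeval (R := k) fun il : Fin n × Fin (r + 1) => chartCoord p J il.1 il.2) from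
      fun a ha => h ha
    rw [chartIdeal, sup_le_iff, Ideal.span_le, Ideal.span_le]
    constructor
    · rintro _ ⟨i, rfl⟩
      simp [RingHom.mem_ker, chartCoord, div_self (hJ i)]
    · rintro _ ⟨c, rfl⟩
      have h := minor_chartCoord hp J c
      rw [SetLike.mem_coe, RingHom.mem_ker, ← h, minor, minor, AlgHom.map_det]
      congr 1
      ext m t
      simp [multiVeronese])

/-- The (prime, in fact maximal) ideal of the point `p` in the coordinate ring of
`X_{r,d,n} ∩ U_J`. -/
noncomputable def pointIdeal (p : Fin n → Projectivization k (Fin (r + 1) → k))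
    (hp : p ∈ X k r d n) (J : Fin n → Fin (r + 1)) (hJ : InChart p J) :
    Ideal (ChartRing k r d n J) :=
  RingHom.ker (evalAt p hp J hJ)

instance (p : Fin n → Projectivization k (Fin (r + 1) → k))
    (hp : p ∈ X k r d n) (J : Fin n → Fin (r + 1)) (hJ : InChart p J) :
    (pointIdeal p hp J hJ).IsPrime :=
  RingHom.ker_isPrime _

/-- `p` is a smooth point of the `k`-scheme `X_{r,d,n}`: the local ring of `X_{r,d,n}` at `p`,
computed in the affine charts through `p`, is smooth over `k`. -/
def IsSmoothPoint (p : Fin n → Projectivization k (Fin (r + 1) → k)) (hp : p ∈ X k r d n) : Prop :=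
  ∀ (J : Fin n → Fin (r + 1)) (hJ : InChart p J), Algebra.IsSmoothAt k (pointIdeal p hp J hJ)

end Points

end PointConfig

/-! Near a configuration `a` lying on a unique quadric `F`, the scheme is governed by the incidence
equations `F(a i) = 0` in the unknowns (quadric, points): the quadric can be recovered from the
points as a row of the adjugate of a suitable 10 by 10 submatrix of the Veronese matrix
(`exists_embedding_adjugate_ne_zero`, `adjRow_vecMul_mem`). The linearised equations send `(φ, δ)`
to `φ(a i) + B(a i, δ i)`, with `B` the polar form of `F`. Moving `a i` solves the `i`-th equation
unless `a i` is singular on `F`, so this map is onto exactly when the singular points among the `a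
i` impose independent conditions on quadrics.

Surjectivity gives smoothness by one Newton step across a square-zero ideal
(`isSmoothAt_of_jacobian`).

Conversely, infinitesimal lifting at a smooth point is tested along arcs over `k[[t]]`. If two
independent quadrics contain `a`, the Veronese matrix drops rank by two, so changing an arc modulo
the ideal `K` of its minors changes the minors only modulo `𝔪K`. Lifting then forces `K = 𝔪K`, hence
`K = 0` by Nakayama, which fails for a general arc (`not_linearIndependent_of_isSmoothAt`). If the
singular points satisfy a relation `e`, moving one of them in a direction `δ` with `F(δ) ≠ 0` is a
first-order deformation, and its second-order obstruction, paired with `e`, is a nonzero multiple of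
`F(δ)` (`eq_zero_of_isSmoothAt`).

It remains to read independence geometrically. Three distinct points always impose independent
conditions on quadrics, while points of a line do so only if they are distinct and at most three.
Diagonalising `F`, the only step that needs characteristic different from two, yields the three
types; in rank two the planes are rational because uniqueness provides a rational point off the
singular line (`classification`). -/

namespace PointConfig

open MvPolynomial

/-! ### Quadratic forms in four variables as coefficient vectors -/

section Quad

variable {R : Type*} [CommRing R]

theorem Mon.exists_eq_single_add_single (m : Mon 3 2) :
    ∃ a b : Fin 4, m.1 = Finsupp.single a 1 + Finsupp.single b 1 := by
  have h : Multiset.card (Finsupp.toMultiset m.1) = 2 := by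
    rw [Finsupp.card_toMultiset, Finsupp.sum_fintype _ _ (by simp)]
    exact (Finset.mem_finsuppAntidiag.1 m.2).1
  obtain ⟨a, b, hab⟩ := Multiset.card_eq_two.1 h
  refine ⟨a, b, ?_⟩
  rw [← Finsupp.toMultiset_toFinsupp m.1, hab, Multiset.insert_eq_cons, ← Multiset.singleton_add,
    Multiset.toFinsupp_add, Multiset.toFinsupp_singleton, Multiset.toFinsupp_singleton]

/-- The first variable of a quadratic monomial. -/
noncomputable def Mon.fst (m : Mon 3 2) : Fin 4 := m.exists_eq_single_add_single.choose

/-- The second variable of a quadratic monomial. -/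
noncomputable def Mon.snd (m : Mon 3 2) : Fin 4 := m.exists_eq_single_add_single.choose_spec.choose

theorem Mon.eq_single_add_single (m : Mon 3 2) :
    m.1 = Finsupp.single m.fst 1 + Finsupp.single m.snd 1 :=
  m.exists_eq_single_add_single.choose_spec.choose_spec

theorem Mon.prod_pow (m : Mon 3 2) (x : Fin 4 → R) : ∏ l, x l ^ m.1 l = x m.fst * x m.snd := by
  rw [m.eq_single_add_single]
  simp only [Finsupp.add_apply, pow_add, Finset.prod_mul_distrib]
  congr 1 <;> simp [Finsupp.single_apply, pow_ite]

theorem Mon.ext_iff_fst_snd (m m' : Mon 3 2) :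
    m = m' ↔ (m.fst = m'.fst ∧ m.snd = m'.snd) ∨ (m.fst = m'.snd ∧ m.snd = m'.fst) := by
  constructor
  · rintro rfl
    exact Or.inl ⟨rfl, rfl⟩
  · rintro (⟨h1, h2⟩ | ⟨h1, h2⟩) <;> apply Subtype.ext <;>
      rw [m.eq_single_add_single, m'.eq_single_add_single, h1, h2]
    exact add_comm _ _

theorem Mon.card : Fintype.card (Mon 3 2) = 10 := by
  rw [Fintype.card_coe, Finset.card_finsuppAntidiag_nat_eq_choose]
  decide

/-- The quadratic form with the given coefficients. -/
noncomputable def quad (v : Mon 3 2 → R) : QuadraticForm R (Fin 4 → R) :=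
  ∑ m, v m • QuadraticMap.linMulLin (LinearMap.proj m.fst) (LinearMap.proj m.snd)

theorem quad_apply (v : Mon 3 2 → R) (x : Fin 4 → R) :
    quad v x = ∑ m, v m * (x m.fst * x m.snd) := by
  simp [quad]

theorem polar_quad (v : Mon 3 2 → R) (x y : Fin 4 → R) :
    QuadraticMap.polar (quad v) x y = ∑ m, v m * (x m.fst * y m.snd + y m.fst * x m.snd) := by
  simp only [QuadraticMap.polar, quad_apply, ← Finset.sum_sub_distrib, Pi.add_apply]
  exact Finset.sum_congr rfl fun m _ => by ring

theorem quad_add_apply (v : Mon 3 2 → R) (x y : Fin 4 → R) :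
    quad v (x + y) = quad v x + QuadraticMap.polar (quad v) x y + quad v y := by
  simp only [QuadraticMap.polar]
  ring

theorem quad_add (v w : Mon 3 2 → R) : quad (v + w) = quad v + quad w := by
  simp [quad, add_smul, Finset.sum_add_distrib]

theorem quad_smul (c : R) (v : Mon 3 2 → R) : quad (c • v) = c • quad v := by
  simp [quad, mul_smul, Finset.smul_sum]

theorem quad_eq_vecMul {n : ℕ} (v : Mon 3 2 → R) (x : Fin n → Fin 4 → R) (i : Fin n) :
    quad v (x i) = Matrix.vecMul v (multiVeronese 3 2 n x) i := by
  simp [quad_apply, Matrix.vecMul, dotProduct, multiVeronese, Mon.prod_pow]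

theorem polar_quad_single_single (v : Mon 3 2 → R) (m : Mon 3 2) (h : m.fst ≠ m.snd) :
    QuadraticMap.polar (quad v) (Pi.single m.fst 1) (Pi.single m.snd 1) = v m := by
  rw [polar_quad, Finset.sum_eq_single m]
  · simp [h]
  · intro m' _ hm'
    rw [Ne, Mon.ext_iff_fst_snd] at hm'
    simp only [Pi.single_apply]
    grind
  · simp

theorem quad_single (v : Mon 3 2 → R) (m : Mon 3 2) (h : m.fst = m.snd) :
    quad v (Pi.single m.fst 1) = v m := by
  rw [quad_apply, Finset.sum_eq_single m]
  · simp [h]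
  · intro m' _ hm'
    rw [Ne, Mon.ext_iff_fst_snd] at hm'
    simp only [Pi.single_apply]
    grind
  · simp

/-- Coefficients are read off from values at basis vectors and polar values at pairs of them, so
this holds over every commutative ring, including small fields and characteristic two. -/
theorem quad_injective : Function.Injective (quad (R := R)) := by
  intro v w hvw
  funext m
  by_cases h : m.fst = m.snd
  · rw [← quad_single v m h, hvw, quad_single w m h]
  · rw [← polar_quad_single_single v m h, hvw, polar_quad_single_single w m h]

theorem map_quad {S : Type*} [CommRing S] (f : R →+* S) (v : Mon 3 2 → R) (x : Fin 4 → R) :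
    f (quad v x) = quad (f ∘ v) (f ∘ x) := by
  simp [quad_apply]

theorem map_polar_quad {S : Type*} [CommRing S] (f : R →+* S) (v : Mon 3 2 → R) (x y : Fin 4 → R) :
    f (QuadraticMap.polar (quad v) x y) = QuadraticMap.polar (quad (f ∘ v)) (f ∘ x) (f ∘ y) := by
  simp [polar_quad]

/-- The coefficients of a quadratic polynomial. -/
def quadCoeff (F : MvPolynomial (Fin 4) R) (m : Mon 3 2) : R := coeff m.1 F

/-- The quadratic polynomial with the given coefficients. -/
noncomputable def quadPoly (v : Mon 3 2 → R) : MvPolynomial (Fin 4) R := ∑ m, monomial m.1 (v m)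

theorem quadPoly_eq (v : Mon 3 2 → R) : quadPoly v = ∑ m, C (v m) * (MvPolynomial.X m.fst * MvPolynomial.X m.snd) := by
  refine Finset.sum_congr rfl fun m _ => ?_
  rw [m.eq_single_add_single, MvPolynomial.X, MvPolynomial.X, monomial_mul, C_mul_monomial]
  simp

theorem isHomogeneous_quadPoly (v : Mon 3 2 → R) : (quadPoly v).IsHomogeneous 2 := by
  refine IsHomogeneous.sum _ _ _ fun m _ => isHomogeneous_monomial _ ?_
  rw [Finsupp.degree_eq_sum]
  exact (Finset.mem_finsuppAntidiag.1 m.2).1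

theorem quadPoly_quadCoeff {F : MvPolynomial (Fin 4) R} (hF : F.IsHomogeneous 2) :
    quadPoly (quadCoeff F) = F := by
  have hdeg : ∀ m ∈ F.support,
      m ∈ Finset.finsuppAntidiag (Finset.univ : Finset (Fin 4)) 2 := by
    intro m hm
    have h1 := hF (mem_support_iff.1 hm)
    rw [Finset.mem_finsuppAntidiag]
    refine ⟨?_, Finset.subset_univ _⟩
    rw [← h1, Finsupp.weight_apply, Finsupp.sum_fintype _ _ (by simp)]
    simp
  conv_rhs => rw [F.as_sum]
  simp only [quadPoly, quadCoeff]
  rw [Finset.sum_coe_sort (Finset.finsuppAntidiag Finset.univ 2)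
      (fun m => monomial m (coeff m F))]
  refine (Finset.sum_subset hdeg fun m _ hm => ?_).symm
  rw [notMem_support_iff.1 hm, map_zero]

theorem quadCoeff_quadPoly (v : Mon 3 2 → R) : quadCoeff (quadPoly v) = v := by
  funext m
  simp only [quadCoeff, quadPoly, coeff_sum, coeff_monomial]
  simp

variable {S : Type*} [CommRing S] [Algebra R S]

theorem aeval_quadPoly (v : Mon 3 2 → R) (x : Fin 4 → S) :
    aeval x (quadPoly v) = quad (algebraMap R S ∘ v) x := by
  simp [quadPoly_eq, quad_apply]

theorem aeval_pderiv_quadPoly (v : Mon 3 2 → R) (x : Fin 4 → S) (j : Fin 4) :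
    aeval x (pderiv j (quadPoly v)) =
      QuadraticMap.polar (quad (algebraMap R S ∘ v)) x (Pi.single j 1) := by
  simp only [quadPoly_eq, map_sum, polar_quad, Derivation.leibniz, pderiv_X, map_add, map_mul,
    smul_eq_mul, pderiv_C, mul_zero, add_zero, aeval_X, aeval_C, Function.comp]
  refine Finset.sum_congr rfl fun m _ => ?_
  simp only [Pi.single_apply, apply_ite (aeval x), map_one, map_zero]
  congr 1
  by_cases h1 : m.fst = j <;> by_cases h2 : m.snd = j <;> simp [h1, h2, add_comm]

theorem polar_eq_sum (v : Mon 3 2 → R) (x y : Fin 4 → R) :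
    QuadraticMap.polar (quad v) x y = ∑ l, y l * QuadraticMap.polar (quad v) x (Pi.single l 1) := by
  simp only [polar_quad, Finset.mul_sum]
  rw [Finset.sum_comm]
  refine Finset.sum_congr rfl fun m _ => ?_
  have (l : Fin 4) : y l * (v m * (x m.fst * (Pi.single l 1 : Fin 4 → R) m.snd +
      (Pi.single l 1 : Fin 4 → R) m.fst * x m.snd)) =
      v m * (x m.fst * (y l * (Pi.single l 1 : Fin 4 → R) m.snd)) +
        v m * (x m.snd * (y l * (Pi.single l 1 : Fin 4 → R) m.fst)) := by ring
  simp only [this, Finset.sum_add_distrib, ← Finset.mul_sum]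
  simp [Pi.single_apply]
  ring

end Quad

/-! ### Nonzero adjugate entries of a matrix of corank one -/

section Columns

variable {ι κ k : Type*} [Fintype ι] [DecidableEq ι] [Fintype κ] [Field k]

/-- If the left kernel of a matrix is spanned by a vector `v` with `v i ≠ 0`, then there is a
square submatrix with all columns but the `i`-th linearly independent. -/
theorem exists_embedding_adjugate_ne_zero (M : Matrix ι κ k)
    (hcard : Fintype.card ι ≤ Fintype.card κ) (v : ι → k) (i : ι) (hvi : v i ≠ 0)
    (hv : Matrix.vecMul v M = 0) (huniq : ∀ w, Matrix.vecMul w M = 0 → ∃ c : k, w = c • v) :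
    ∃ (c : ι ↪ κ) (j : ι), (M.submatrix id c).adjugate i j ≠ 0 := by
  obtain ⟨κ', a, ha, hspan, hli⟩ := exists_linearIndependent' k M.transpose
  have : Finite κ' := Finite.of_injective a ha
  have : Fintype κ' := Fintype.ofFinite κ'
  -- The columns span the hyperplane orthogonal to `v`, which misses this basis vector because `v i
  -- ≠ 0`. Hence a maximal independent family of columns together with `b` is a basis.
  set b : ι → k := Pi.single i 1 with hb
  set u : Option κ' → ι → k := fun o => o.elim b (M.transpose ∘ a) with hu
  have hzero : ∀ x ∈ Submodule.span k (Set.range M.transpose), v ⬝ᵥ x = 0 := by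
    intro x hx
    induction hx using Submodule.span_induction with
    | mem x hx =>
      obtain ⟨j, rfl⟩ := hx
      exact congrFun hv j
    | zero => simp
    | add x y _ _ hx hy => rw [dotProduct_add, hx, hy, add_zero]
    | smul c x _ hx => rw [dotProduct_smul, hx, smul_zero]
  have hbs : b ∉ Submodule.span k (Set.range (M.transpose ∘ a)) := by
    rw [hspan]
    intro h
    have := hzero b h
    rw [hb, dotProduct_single_one] at this
    exact hvi this
  have hui : LinearIndependent k u := by
    have := linearIndependent_option' (K := k) (v := M.transpose ∘ a) (x := b)
    have h : u = fun o => o.casesOn' b (M.transpose ∘ a) := by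
      funext o
      cases o <;> rfl
    rw [h]
    exact this.2 ⟨hli, hbs⟩
  have hut : ⊤ ≤ Submodule.span k (Set.range u) := by
    by_contra hlt
    obtain ⟨f, hf0, hf⟩ := Submodule.exists_le_ker_of_lt_top _ (lt_top_iff_ne_top.2
      fun h => hlt h.ge)
    have hfx : ∀ x : ι → k, f x = (fun j => f (Pi.single j 1)) ⬝ᵥ x := by
      intro x
      conv_lhs => rw [pi_eq_sum_univ' x]
      simp [dotProduct, mul_comm]
    have hf1 : f b = 0 := hf (Submodule.subset_span ⟨none, rfl⟩)
    have hle : Submodule.span k (Set.range M.transpose) ≤ LinearMap.ker f := by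
      rw [← hspan]
      refine le_trans (Submodule.span_mono ?_) hf
      rintro _ ⟨x, rfl⟩
      exact ⟨some x, rfl⟩
    obtain ⟨c, hc⟩ := huniq (fun j => f (Pi.single j 1)) (by
      funext j
      exact (hfx _).symm.trans (hle (Submodule.subset_span ⟨j, rfl⟩)))
    have h1 := congrFun hc i
    rw [Pi.smul_apply, smul_eq_mul, ← hb, hf1] at h1
    have hc0 : c = 0 := by
      rcases mul_eq_zero.1 h1.symm with h | h
      · exact h
      · exact absurd h hvi
    refine hf0 (LinearMap.ext fun x => ?_)
    rw [hfx, hc, hc0]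
    simp
  set B := Module.Basis.mk hui hut with hB
  have hcards : Fintype.card (Option κ') = Fintype.card ι := by
    rw [← Module.finrank_eq_card_basis B, Module.finrank_fintype_fun_eq_card]
  obtain ⟨e, he⟩ : ∃ e : ι ≃ Option κ', e i = none := by
    classical
    let e' := (Fintype.equivOfCardEq hcards).symm
    exact ⟨e'.trans (Equiv.swap (e' i) none), by simp⟩
  -- The family has one column fewer than `ι` has elements, so an unused column is left to fill
  -- position `i`; its entries are irrelevant.
  obtain ⟨j, hj⟩ : ∃ j, j ∉ Set.range a := by
    by_contra hcon
    push Not at hcon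
    have := Fintype.card_le_of_surjective a hcon
    rw [Fintype.card_option] at hcards
    omega
  have hinj : Function.Injective (fun o : Option κ' => o.elim j a) := by
    rintro (_ | x) (_ | y) h
    · rfl
    · exact absurd ⟨y, h.symm⟩ hj
    · exact absurd ⟨x, h⟩ hj
    · exact congrArg some (ha h)
  refine ⟨⟨fun m => (e m).elim j a, hinj.comp e.injective⟩, ?_⟩
  by_contra! h0
  set c : ι ↪ κ := ⟨fun m => (e m).elim j a, hinj.comp e.injective⟩
  -- By Cramer's rule, row `i` of the adjugate computes the determinant with column `i` replaced by
  -- `b`; those columns form the basis found above.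
  have hdet : ((M.submatrix id c).updateCol i b).det = 0 := by
    rw [← Matrix.cramer_apply, Matrix.cramer_eq_adjugate_mulVec]
    simp [Matrix.mulVec, h0]
  obtain ⟨w, hw0, hw⟩ := Matrix.exists_vecMul_eq_zero_iff.2 hdet
  refine hw0 ?_
  have hwu : ∀ o, w ⬝ᵥ u o = 0 := by
    intro o
    obtain ⟨m, rfl⟩ := e.surjective o
    have hm := congrFun hw m
    simp only [Matrix.vecMul, Pi.zero_apply] at hm
    rw [← hm]
    congr 1
    funext l
    by_cases hmi : m = i
    · subst hmi
      simp [hu, he]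
    · have : e m ≠ none := fun h => hmi (e.injective (h.trans he.symm))
      obtain ⟨y, hy⟩ := Option.ne_none_iff_exists'.1 this
      simp only [hu, c, hy, Matrix.updateCol_ne hmi]
      simp [hy]
      rfl
  have hall : ∀ x, w ⬝ᵥ x = 0 := by
    intro x
    have hx := hut (Submodule.mem_top (x := x))
    induction hx using Submodule.span_induction with
    | mem x hx =>
      obtain ⟨o, rfl⟩ := hx
      exact hwu o
    | zero => simp
    | add x y _ _ hx hy => rw [dotProduct_add, hx, hy, add_zero]
    | smul c x _ hx => rw [dotProduct_smul, hx, smul_zero]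
  funext m
  simpa using hall (Pi.single m 1)

end Columns

/-! ### Passing between vanishing minors and a form through the points -/

section Minors

variable {R S : Type*} [CommRing R] [CommRing S] {r d n : ℕ}

theorem map_minor (f : R →+* S) (x : Fin n → Fin (r + 1) → R) (c : Mon r d ↪ Fin n) :
    f (minor r d n x c) = minor r d n (fun i l => f (x i l)) c := by
  rw [minor, minor, RingHom.map_det]
  congr 1
  ext m t
  simp [multiVeronese]

/-- A form through the points `x` when all the minors of `x` vanish: a row of the adjugate of
a square submatrix of the multi-Veronese matrix. -/
noncomputable def adjRow (x : Fin n → Fin (r + 1) → R) (c : Mon r d ↪ Fin n) (m : Mon r d) :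
    Mon r d → R :=
  fun m' => ((multiVeronese r d n x).submatrix id c).adjugate m m'

theorem map_adjRow (f : R →+* S) (x : Fin n → Fin (r + 1) → R) (c : Mon r d ↪ Fin n)
    (m : Mon r d) : f ∘ adjRow x c m = adjRow (fun i l => f (x i l)) c m := by
  have h : f.mapMatrix ((multiVeronese r d n x).submatrix id c) =
      (multiVeronese r d n fun i l => f (x i l)).submatrix id c := by
    ext m t
    simp [multiVeronese]
  funext m'
  simp only [adjRow, ← h, ← RingHom.map_adjugate]
  rfl

/-- By Cramer's rule the value at point `i` is the determinant with column `m` replaced by the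
Veronese column of `i`: it has a repeated column or is again a maximal minor. -/
theorem adjRow_vecMul_mem {L : Ideal R} {x : Fin n → Fin (r + 1) → R}
    (hx : ∀ c : Mon r d ↪ Fin n, minor r d n x c ∈ L) (c : Mon r d ↪ Fin n) (m : Mon r d)
    (i : Fin n) : Matrix.vecMul (adjRow x c m) (multiVeronese r d n x) i ∈ L := by
  have h1 : Matrix.vecMul (adjRow x c m) (multiVeronese r d n x) i =
      (((multiVeronese r d n x).submatrix id c).updateCol m
        fun l => multiVeronese r d n x l i).det := by
    rw [← Matrix.cramer_apply, Matrix.cramer_eq_adjugate_mulVec]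
    rfl
  rw [h1]
  by_cases hi : ∃ m', m' ≠ m ∧ c m' = i
  · obtain ⟨m', hm', rfl⟩ := hi
    rw [Matrix.det_zero_of_column_eq hm']
    · exact L.zero_mem
    · intro l
      simp [hm']
  · push Not at hi
    have hinj : Function.Injective (Function.update c m i) := by
      intro a b hab
      by_cases ha : a = m <;> by_cases hb : b = m
      · rw [ha, hb]
      · subst ha
        simp only [Function.update_self, Function.update_of_ne hb] at hab
        exact absurd hab.symm (hi b hb)
      · subst hb
        simp only [Function.update_self, Function.update_of_ne ha] at hab
        exact absurd hab (hi a ha)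
      · simp only [Function.update_of_ne ha, Function.update_of_ne hb] at hab
        exact c.injective hab
    convert hx ⟨_, hinj⟩ using 1
    rw [minor]
    congr 1
    ext l m'
    by_cases hm' : m' = m
    · subst hm'
      simp
    · simp [hm']

/-- Multiply `v A` by the adjugate to get `det A • v`, then cancel the unit coefficient. Over rings
with nilpotents a merely nonzero `v` would not suffice. -/
theorem minor_mem_of_vecMul_mem {L : Ideal R} {x : Fin n → Fin (r + 1) → R} {v : Mon r d → R}
    {m : Mon r d} (hm : IsUnit (v m))
    (hv : ∀ i, Matrix.vecMul v (multiVeronese r d n x) i ∈ L) (c : Mon r d ↪ Fin n) :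
    minor r d n x c ∈ L := by
  set A := (multiVeronese r d n x).submatrix id c with hA
  have h1 : A.det * v m = Matrix.vecMul (Matrix.vecMul v A) A.adjugate m := by
    rw [Matrix.vecMul_vecMul, Matrix.mul_adjugate, Matrix.vecMul_smul, Matrix.vecMul_one]
    rfl
  have h2 : A.det * v m ∈ L := by
    rw [h1]
    exact L.sum_mem fun i _ => L.mul_mem_right _ (hv (c i))
  exact (Ideal.mul_unit_mem_iff_mem L hm).1 h2

end Minors

/-! ### Smoothness as infinitesimal lifting of configurations -/

section Lifting

variable {k : Type*} [Field k] {r d n : ℕ}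

theorem evalAt_mk (p : Fin n → Projectivization k (Fin (r + 1) → k)) (hp : p ∈ X k r d n)
    (J : Fin n → Fin (r + 1)) (hJ : InChart p J) (f : MvPolynomial (Fin n × Fin (r + 1)) k) :
    evalAt p hp J hJ (Ideal.Quotient.mk _ f) =
      aeval (fun il : Fin n × Fin (r + 1) => chartCoord p J il.1 il.2) f :=
  rfl

theorem chartCoord_self {p : Fin n → Projectivization k (Fin (r + 1) → k)}
    {J : Fin n → Fin (r + 1)} (hJ : InChart p J) (i : Fin n) : chartCoord p J i (J i) = 1 :=
  div_self (hJ i)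

/-- A point of `X_{r,d,n} ∩ U_J` with values in a `k`-algebra. -/
noncomputable def chartPoint {B : Type*} [CommRing B] [Algebra k B] (J : Fin n → Fin (r + 1))
    (x : Fin n → Fin (r + 1) → B) (hxJ : ∀ i, x i (J i) = 1)
    (hx : ∀ c : Mon r d ↪ Fin n, minor r d n x c = 0) : ChartRing k r d n J →ₐ[k] B :=
  Ideal.Quotient.liftₐ (chartIdeal k r d n J)
    (aeval fun il : Fin n × Fin (r + 1) => x il.1 il.2) (by
    suffices h : chartIdeal k r d n J ≤
        RingHom.ker (aeval (R := k) fun il : Fin n × Fin (r + 1) => x il.1 il.2) from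
      fun a ha => h ha
    rw [chartIdeal, sup_le_iff, Ideal.span_le, Ideal.span_le]
    constructor
    · rintro _ ⟨i, rfl⟩
      simp [RingHom.mem_ker, hxJ]
    · rintro _ ⟨c, rfl⟩
      rw [SetLike.mem_coe, RingHom.mem_ker, ← hx c, ← AlgHom.coe_toRingHom, map_minor]
      simp)

theorem chartPoint_mk {B : Type*} [CommRing B] [Algebra k B] (J : Fin n → Fin (r + 1))
    (x : Fin n → Fin (r + 1) → B) (hxJ : ∀ i, x i (J i) = 1)
    (hx : ∀ c : Mon r d ↪ Fin n, minor r d n x c = 0) (f : MvPolynomial (Fin n × Fin (r + 1)) k) :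
    chartPoint J x hxJ hx (Ideal.Quotient.mk _ f) =
      aeval (fun il : Fin n × Fin (r + 1) => x il.1 il.2) f :=
  rfl

theorem minor_map_chartRing_eq_zero {B : Type*} [CommRing B] [Algebra k B]
    {J : Fin n → Fin (r + 1)} (g : ChartRing k r d n J →ₐ[k] B) (c : Mon r d ↪ Fin n) :
    minor r d n (fun i l => g (Ideal.Quotient.mk _ (MvPolynomial.X (i, l)))) c = 0 := by
  have h := map_minor ((g : ChartRing k r d n J →+* B).comp
    (Ideal.Quotient.mk (chartIdeal k r d n J))) (fun i l => MvPolynomial.X (i, l)) c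
  refine Eq.trans h.symm ?_
  rw [RingHom.comp_apply, Ideal.Quotient.eq_zero_iff_mem.2, map_zero]
  exact Ideal.mem_sup_right (Ideal.subset_span ⟨c, rfl⟩)

theorem map_chartRing_chart {B : Type*} [CommRing B] [Algebra k B]
    {J : Fin n → Fin (r + 1)} (g : ChartRing k r d n J →ₐ[k] B) (i : Fin n) :
    g (Ideal.Quotient.mk _ (MvPolynomial.X (i, J i))) = 1 := by
  rw [← map_one g, ← map_one (Ideal.Quotient.mk (chartIdeal k r d n J))]
  congr 1
  rw [Ideal.Quotient.eq]
  exact Ideal.mem_sup_left (Ideal.subset_span ⟨i, rfl⟩)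

/-- Infinitesimal lifting at a smooth point for local `k`-algebras with residue field `k`. -/
theorem exists_lift_of_isSmoothAt {B : Type*} [CommRing B] [Algebra k B]
    {p : Fin n → Projectivization k (Fin (r + 1) → k)} {hp : p ∈ X k r d n}
    {J : Fin n → Fin (r + 1)} {hJ : InChart p J} (hs : Algebra.IsSmoothAt k (pointIdeal p hp J hJ))
    (ε : B →ₐ[k] k) [IsLocalHom ε] (I : Ideal B) (hI : IsNilpotent I)
    (x : Fin n → Fin (r + 1) → B) (hxJ : ∀ i, x i (J i) = 1)
    (hεx : ∀ i l, ε (x i l) = chartCoord p J i l)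
    (hx : ∀ c : Mon r d ↪ Fin n, minor r d n x c ∈ I) :
    ∃ y : Fin n → Fin (r + 1) → B, (∀ i l, y i l - x i l ∈ I) ∧ (∀ i, y i (J i) = 1) ∧
      ∀ c : Mon r d ↪ Fin n, minor r d n y c = 0 := by
  let g₀ : ChartRing k r d n J →ₐ[k] B ⧸ I :=
    chartPoint J (fun i l => Ideal.Quotient.mk I (x i l)) (fun i => by rw [hxJ, map_one])
      (fun c => by rw [← map_minor, Ideal.Quotient.eq_zero_iff_mem]; exact hx c)
  -- Since `ε` is local and sends `x` to the coordinates of `p`, functions not vanishing at `p`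
  -- become units, so the point factors through the localization.
  have hunit : ∀ s : (pointIdeal p hp J hJ).primeCompl, IsUnit (g₀ s) := by
    rintro ⟨s, hs⟩
    obtain ⟨f, rfl⟩ := Ideal.Quotient.mk_surjective s
    have h1 : ε (aeval (fun il : Fin n × Fin (r + 1) => x il.1 il.2) f) =
        evalAt p hp J hJ (Ideal.Quotient.mk _ f) := by
      rw [evalAt_mk, ← AlgHom.comp_apply, comp_aeval]
      simp only [hεx]
    have h2 : IsUnit (aeval (fun il : Fin n × Fin (r + 1) => x il.1 il.2) f) := by
      refine isUnit_of_map_unit ε _ ?_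
      rw [h1]
      exact isUnit_iff_ne_zero.2 hs
    have h3 : g₀ (Ideal.Quotient.mk _ f) =
        Ideal.Quotient.mkₐ k I (aeval (fun il : Fin n × Fin (r + 1) => x il.1 il.2) f) := by
      rw [chartPoint_mk, ← AlgHom.comp_apply, comp_aeval]
      rfl
    rw [h3]
    exact h2.map _
  let g : Localization.AtPrime (pointIdeal p hp J hJ) →ₐ[k] B ⧸ I :=
    IsLocalization.liftAlgHom (M := (pointIdeal p hp J hJ).primeCompl) (f := g₀) hunit
  obtain ⟨h, hh⟩ :=
    Algebra.FormallySmooth.exists_lift (R := k)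
      (A := Localization.AtPrime (pointIdeal p hp J hJ)) I hI g
  let h₀ : ChartRing k r d n J →ₐ[k] B := h.comp (IsScalarTower.toAlgHom k (ChartRing k r d n J)
    (Localization.AtPrime (pointIdeal p hp J hJ)))
  refine ⟨fun i l => h₀ (Ideal.Quotient.mk _ (MvPolynomial.X (i, l))), fun i l => ?_,
    map_chartRing_chart h₀, minor_map_chartRing_eq_zero h₀⟩
  rw [← Ideal.Quotient.eq]
  have h1 := congrArg (fun φ => φ (algebraMap (ChartRing k r d n J)
    (Localization.AtPrime (pointIdeal p hp J hJ))
    (Ideal.Quotient.mk _ (MvPolynomial.X (i, l))))) hh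
  refine h1.trans ?_
  have h2 : g (algebraMap (ChartRing k r d n J)
      (Localization.AtPrime (pointIdeal p hp J hJ))
      (Ideal.Quotient.mk _ (MvPolynomial.X (i, l)))) =
      g₀ (Ideal.Quotient.mk _ (MvPolynomial.X (i, l))) :=
    IsLocalization.lift_eq _ _
  rw [h2, chartPoint_mk, aeval_X]

/-- Infinitesimal lifting at a smooth point, phrased in a local `k`-algebra with residue
field `k`, modulo an ideal `L`. -/
theorem exists_lift_mod_of_isSmoothAt {R : Type*} [CommRing R] [Algebra k R]
    {p : Fin n → Projectivization k (Fin (r + 1) → k)} {hp : p ∈ X k r d n}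
    {J : Fin n → Fin (r + 1)} {hJ : InChart p J} (hs : Algebra.IsSmoothAt k (pointIdeal p hp J hJ))
    (ε : R →ₐ[k] k) [IsLocalHom ε] (K L : Ideal R) (hKL : K ^ 2 ≤ L) (hLK : L ≤ K)
    (hL : L ≤ RingHom.ker ε) (x : Fin n → Fin (r + 1) → R) (hxJ : ∀ i, x i (J i) = 1)
    (hεx : ∀ i l, ε (x i l) = chartCoord p J i l)
    (hx : ∀ c : Mon r d ↪ Fin n, minor r d n x c ∈ K) :
    ∃ y : Fin n → Fin (r + 1) → R, (∀ i l, y i l - x i l ∈ K) ∧ (∀ i, y i (J i) - 1 ∈ L) ∧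
      ∀ c : Mon r d ↪ Fin n, minor r d n y c ∈ L := by
  let ε' : R ⧸ L →ₐ[k] k := Ideal.Quotient.liftₐ L ε fun a ha => hL ha
  have : IsLocalHom ε' := ⟨fun a ha => by
    obtain ⟨a, rfl⟩ := Ideal.Quotient.mk_surjective a
    exact (isUnit_of_map_unit ε a ha).map (Ideal.Quotient.mk L)⟩
  obtain ⟨y, hyx, hyJ, hy⟩ := exists_lift_of_isSmoothAt hs ε' (K.map (Ideal.Quotient.mk L))
    ⟨2, by
      rw [← Ideal.map_pow, Ideal.zero_eq_bot, Ideal.map_eq_bot_iff_le_ker, Ideal.mk_ker]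
      exact hKL⟩
    (fun i l => Ideal.Quotient.mk L (x i l)) (fun i => by rw [hxJ, map_one])
    (fun i l => hεx i l)
    (fun c => by rw [← map_minor]; exact Ideal.mem_map_of_mem _ (hx c))
  choose z hz using fun i l => Ideal.Quotient.mk_surjective (y i l)
  obtain rfl : y = fun i l => Ideal.Quotient.mk L (z i l) := by
    funext i l
    exact (hz i l).symm
  refine ⟨z, fun i l => ?_, fun i => ?_, fun c => ?_⟩
  · have h := hyx i l
    rw [← map_sub, Ideal.mem_quotient_iff_mem hLK] at h
    exact h
  · rw [← Ideal.Quotient.eq, map_one]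
    exact hyJ i
  · rw [← Ideal.Quotient.eq_zero_iff_mem, map_minor]
    exact hy c

/-- A criterion for smoothness by infinitesimal lifting of points. -/
theorem isSmoothAt_of_lift.{u} {k : Type u} [Field k]
    {p : Fin n → Projectivization k (Fin (r + 1) → k)} {hp : p ∈ X k r d n}
    {J : Fin n → Fin (r + 1)} {hJ : InChart p J}
    (H : ∀ {B : Type u} [CommRing B] [Algebra k B] (I : Ideal B) (x : Fin n → Fin (r + 1) → B),
      I ^ 2 = ⊥ → (∀ i, x i (J i) = 1) → (∀ c : Mon r d ↪ Fin n, minor r d n x c ∈ I) →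
      (∀ f : MvPolynomial (Fin n × Fin (r + 1)) k,
        aeval (fun il : Fin n × Fin (r + 1) => chartCoord p J il.1 il.2) f ≠ 0 →
          IsUnit (aeval (fun il : Fin n × Fin (r + 1) => x il.1 il.2) f)) →
      ∃ y : Fin n → Fin (r + 1) → B, (∀ i l, y i l - x i l ∈ I) ∧ (∀ i, y i (J i) = 1) ∧
        ∀ c : Mon r d ↪ Fin n, minor r d n y c = 0) :
    Algebra.IsSmoothAt k (pointIdeal p hp J hJ) := by
  refine Algebra.FormallySmooth.of_comp_surjective ?_
  intro B _ _ I hI g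
  have hnil : IsNilpotent I := ⟨2, hI⟩
  have hmk_unit : ∀ b : B, IsUnit (Ideal.Quotient.mk I b) → IsUnit b := by
    intro b hb
    exact (IsNilpotent.isUnit_quotient_mk_iff hnil).1 hb
  let g₀ : ChartRing k r d n J →ₐ[k] B ⧸ I := g.comp (IsScalarTower.toAlgHom k (ChartRing k r d n J)
    (Localization.AtPrime (pointIdeal p hp J hJ)))
  choose x' hx' using fun i l =>
    Ideal.Quotient.mk_surjective (g₀ (Ideal.Quotient.mk _ (MvPolynomial.X (i, l))))
  -- The normalised coordinate is lifted to exactly 1, so that the lift stays in the chart.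
  let x : Fin n → Fin (r + 1) → B := fun i l => if l = J i then 1 else x' i l
  have hx : ∀ i l, Ideal.Quotient.mk I (x i l) =
      g₀ (Ideal.Quotient.mk _ (MvPolynomial.X (i, l))) := by
    intro i l
    by_cases hl : l = J i
    · subst hl
      simp [x, map_chartRing_chart]
    · simp [x, hl, hx']
  have hgx : ∀ (z : Fin n → Fin (r + 1) → B), (∀ i l, Ideal.Quotient.mk I (z i l) =
      g₀ (Ideal.Quotient.mk _ (MvPolynomial.X (i, l)))) →
      ∀ f : MvPolynomial (Fin n × Fin (r + 1)) k,
      Ideal.Quotient.mkₐ k I (aeval (fun il : Fin n × Fin (r + 1) => z il.1 il.2) f) =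
      g₀ (Ideal.Quotient.mk _ f) := by
    intro z hz f
    have : (Ideal.Quotient.mkₐ k I).comp (aeval (fun il : Fin n × Fin (r + 1) => z il.1 il.2)) =
        g₀.comp (Ideal.Quotient.mkₐ k _) := by
      refine MvPolynomial.algHom_ext fun il => ?_
      simp only [AlgHom.comp_apply, aeval_X]
      exact hz il.1 il.2
    exact DFunLike.congr_fun this f
  -- Stated for an arbitrary lift `z`, because it is needed both for the first lift `x` and for the
  -- corrected lift `y`.
  have hunit : ∀ (z : Fin n → Fin (r + 1) → B), (∀ i l, Ideal.Quotient.mk I (z i l) =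
      g₀ (Ideal.Quotient.mk _ (MvPolynomial.X (i, l)))) →
      ∀ f : MvPolynomial (Fin n × Fin (r + 1)) k,
        aeval (fun il : Fin n × Fin (r + 1) => chartCoord p J il.1 il.2) f ≠ 0 →
          IsUnit (aeval (fun il : Fin n × Fin (r + 1) => z il.1 il.2) f) := by
    intro z hz f hf
    refine hmk_unit _ ?_
    have h1 := hgx z hz f
    rw [Ideal.Quotient.mkₐ_eq_mk] at h1
    rw [h1]
    exact (IsLocalization.map_units (Localization.AtPrime (pointIdeal p hp J hJ))
      (⟨Ideal.Quotient.mk _ f, hf⟩ : (pointIdeal p hp J hJ).primeCompl)).map g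
  obtain ⟨y, hyx, hyJ, hy⟩ := H I x hI (fun i => by simp [x])
    (fun c => by
      rw [← Ideal.Quotient.eq_zero_iff_mem, map_minor]
      simp only [hx]
      exact minor_map_chartRing_eq_zero g₀ c)
    (hunit x hx)
  have hymk : ∀ i l, Ideal.Quotient.mk I (y i l) =
      g₀ (Ideal.Quotient.mk _ (MvPolynomial.X (i, l))) := fun i l => by
    rw [← hx, Ideal.Quotient.eq]
    exact hyx i l
  let h₀ : ChartRing k r d n J →ₐ[k] B := chartPoint J y hyJ hy
  have h₀unit : ∀ s : (pointIdeal p hp J hJ).primeCompl, IsUnit (h₀ s) := by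
    rintro ⟨s, hs⟩
    obtain ⟨f, rfl⟩ := Ideal.Quotient.mk_surjective s
    exact hunit y hymk f hs
  refine ⟨IsLocalization.liftAlgHom (M := (pointIdeal p hp J hJ).primeCompl) (f := h₀) h₀unit, ?_⟩
  refine IsLocalization.algHom_ext (A := ChartRing k r d n J) (pointIdeal p hp J hJ).primeCompl ?_
  refine AlgHom.ext fun s => ?_
  obtain ⟨f, rfl⟩ := Ideal.Quotient.mk_surjective s
  refine Eq.trans ?_ (hgx y hymk f)
  exact congrArg (Ideal.Quotient.mkₐ k I) (IsLocalization.lift_eq _ _)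

end Lifting

/-! ### The Jacobian criterion for the incidence equations -/

section Sufficiency

variable {k : Type*} [Field k] {n : ℕ}

/-- The value at `z` of the linearisation of the incidence equations, evaluated at the tangent
vectors `(φ j, δ j)`; the quadric is the one given by `adjRow`. -/
noncomputable def incidenceJacobian {S : Type*} [CommRing S] [Algebra k S] (c : Mon 3 2 ↪ Fin n)
    (m : Mon 3 2) (φ : Fin n → Mon 3 2 → k) (δ : Fin n → Fin n → Fin 4 → k)
    (z : Fin n → Fin 4 → S) : Matrix (Fin n) (Fin n) S :=
  Matrix.of fun i j => quad (algebraMap k S ∘ φ j) (z i) +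
    QuadraticMap.polar (quad (adjRow (r := 3) z c m)) (z i) (algebraMap k S ∘ δ j i)

theorem map_det_incidenceJacobian {S T : Type*} [CommRing S] [Algebra k S] [CommRing T]
    [Algebra k T] (f : S →ₐ[k] T) (c : Mon 3 2 ↪ Fin n)
    (m : Mon 3 2) (φ : Fin n → Mon 3 2 → k) (δ : Fin n → Fin n → Fin 4 → k)
    (z : Fin n → Fin 4 → S) :
    f (incidenceJacobian c m φ δ z).det = (incidenceJacobian c m φ δ fun i l => f (z i l)).det := by
  rw [AlgHom.map_det]
  congr 1
  ext i j
  have h1 (u : Mon 3 2 → k) : (f : S →+* T) ∘ algebraMap k S ∘ u = algebraMap k T ∘ u := by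
    funext; simp
  have h2 (u : Fin 4 → k) : (f : S →+* T) ∘ algebraMap k S ∘ u = algebraMap k T ∘ u := by
    funext; simp
  simp only [incidenceJacobian, AlgHom.mapMatrix_apply, Matrix.map_apply, Matrix.of_apply, map_add]
  rw [← AlgHom.coe_toRingHom, map_quad, map_polar_quad, h1, h2, map_adjRow]
  rfl

theorem polar_quad_mem_sq {B : Type*} [CommRing B] {I : Ideal B} {v : Mon 3 2 → B}
    (hv : ∀ m, v m ∈ I) (x : Fin 4 → B) {y : Fin 4 → B} (hy : ∀ l, y l ∈ I) :
    QuadraticMap.polar (quad v) x y ∈ I ^ 2 := by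
  rw [polar_quad, pow_two]
  exact Ideal.sum_mem _ fun m _ => Ideal.mul_mem_mul (hv m) (I.add_mem (I.mul_mem_left _ (hy _))
    (I.mul_mem_right _ (hy _)))

theorem quad_mem_sq {B : Type*} [CommRing B] {I : Ideal B} (v : Mon 3 2 → B)
    {y : Fin 4 → B} (hy : ∀ l, y l ∈ I) : quad v y ∈ I ^ 2 := by
  rw [quad_apply, pow_two]
  exact Ideal.sum_mem _ fun m _ => Ideal.mul_mem_left _ _ (Ideal.mul_mem_mul (hy _) (hy _))

/-- The Jacobian criterion for the incidence variety of configurations on quadrics. -/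
theorem isSmoothAt_of_jacobian {p : Fin n → Projectivization k (Fin (3 + 1) → k)}
    {hp : p ∈ X k 3 2 n} {J : Fin n → Fin (3 + 1)} {hJ : InChart p J} (c : Mon 3 2 ↪ Fin n)
    (m m₁ : Mon 3 2) (hm : adjRow (chartCoord p J) c m m₁ ≠ 0)
    (hsurj : ∀ j, ∃ (φ : Mon 3 2 → k) (δ : Fin n → Fin 4 → k), (∀ i, δ i (J i) = 0) ∧
      ∀ i, quad φ (chartCoord p J i) + QuadraticMap.polar (quad (adjRow (chartCoord p J) c m))
        (chartCoord p J i) (δ i) = if i = j then 1 else 0) :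
    Algebra.IsSmoothAt k (pointIdeal p hp J hJ) := by
  choose φ δ hδJ hφδ using hsurj
  refine isSmoothAt_of_lift fun {B} _ _ I x hI hxJ hx hunit => ?_
  set v := adjRow (r := 3) x c m with hv
  have hε : ∀ i, quad v (x i) ∈ I := fun i => by
    rw [quad_eq_vecMul]
    exact adjRow_vecMul_mem hx c m i
  -- The determinant is a polynomial in the coordinates whose value at `p` is 1, since the chosen
  -- tangent vectors make the Jacobian the identity there.
  have hdet : IsUnit (incidenceJacobian c m φ δ x).det := by
    have h1 := hunit (incidenceJacobian c m φ δ
      (fun i l => (MvPolynomial.X (i, l) : MvPolynomial (Fin n × Fin 4) k))).det (by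
        rw [map_det_incidenceJacobian]
        simp only [aeval_X]
        have : incidenceJacobian c m φ δ (chartCoord p J) = 1 := by
          ext i j
          simp only [incidenceJacobian, Matrix.of_apply, Matrix.one_apply, ← hφδ j i]
          rfl
        have h2 := congrArg Matrix.det this
        rw [Matrix.det_one] at h2
        rw [show (incidenceJacobian c m φ δ fun i l => chartCoord p J i l).det = 1 from h2]
        exact one_ne_zero)
    rw [map_det_incidenceJacobian] at h1
    simpa only [aeval_X] using h1
  have hvm : IsUnit (v m₁) := by
    have h3 : ∀ {S : Type _} [CommRing S] [Algebra k S] (z : Fin n → Fin 4 → S),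
        aeval (fun il : Fin n × Fin 4 => z il.1 il.2) (adjRow (r := 3)
          (fun i l => (MvPolynomial.X (i, l) : MvPolynomial (Fin n × Fin 4) k)) c m m₁) =
        adjRow (r := 3) z c m m₁ := by
      intro S _ _ z
      have := congrFun (map_adjRow (r := 3)
        ((aeval (fun il : Fin n × Fin 4 => z il.1 il.2) :
          MvPolynomial (Fin n × Fin 4) k →ₐ[k] S) : MvPolynomial (Fin n × Fin 4) k →+* S)
        (fun i l => (MvPolynomial.X (i, l) : MvPolynomial (Fin n × Fin 4) k)) c m) m₁
      simpa only [AlgHom.coe_toRingHom, aeval_X] using! this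
    have h4 := hunit (adjRow (r := 3)
          (fun i l => (MvPolynomial.X (i, l) : MvPolynomial (Fin n × Fin 4) k)) c m m₁) (by
        rw [h3]
        exact hm)
    rwa [h3] at h4
  set N := incidenceJacobian c m φ δ x with hN
  -- Newton step: solve the linearised equations with right-hand side `-F(x i)`. The correction lies
  -- in `I`, so all quadratic error terms vanish.
  set s : Fin n → B := N⁻¹.mulVec (fun i => - quad v (x i)) with hs
  have hNs : ∀ i, ∑ j, N i j * s j = - quad v (x i) := by
    intro i
    have : N.mulVec s = fun i => - quad v (x i) := by
      rw [hs, Matrix.mulVec_mulVec, Matrix.mul_nonsing_inv _ hdet, Matrix.one_mulVec]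
    exact congrFun this i
  have hsI : ∀ j, s j ∈ I := fun j => by
    simp only [hs, Matrix.mulVec, dotProduct]
    exact I.sum_mem fun i _ => I.mul_mem_left _ (I.neg_mem (hε i))
  set Φ : Mon 3 2 → B := ∑ j, s j • (algebraMap k B ∘ φ j) with hΦ
  set Δ : Fin n → Fin 4 → B := fun i => ∑ j, s j • (algebraMap k B ∘ δ j i) with hΔ
  have hΦI : ∀ a, Φ a ∈ I := fun a => by
    simp only [hΦ, Finset.sum_apply, Pi.smul_apply, smul_eq_mul]
    exact I.sum_mem fun j _ => I.mul_mem_right _ (hsI j)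
  have hΔI : ∀ i l, Δ i l ∈ I := fun i l => by
    simp only [hΔ, Finset.sum_apply, Pi.smul_apply, smul_eq_mul]
    exact I.sum_mem fun j _ => I.mul_mem_right _ (hsI j)
  have hΔJ : ∀ i, Δ i (J i) = 0 := fun i => by
    simp [hΔ, hδJ]
  have hbot : ∀ b ∈ I ^ 2, b = 0 := fun b hb => by rwa [hI] at hb
  have hlin : ∀ i, quad Φ (x i) + QuadraticMap.polar (quad v) (x i) (Δ i) =
      - quad v (x i) := by
    intro i
    rw [← hNs]
    simp only [hN, incidenceJacobian, Matrix.of_apply, add_mul, Finset.sum_add_distrib]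
    congr 1
    · simp only [hΦ, quad_apply, Finset.sum_apply, Pi.smul_apply, smul_eq_mul, Finset.sum_mul]
      rw [Finset.sum_comm]
      exact Finset.sum_congr rfl fun j _ => Finset.sum_congr rfl fun a _ => by ring
    · have h5 := map_sum ((quad v).polarBilin (x i)) (fun j => s j • (algebraMap k B ∘ δ j i))
        Finset.univ
      refine h5.trans (Finset.sum_congr rfl fun j _ => ?_)
      rw [map_smul, smul_eq_mul, mul_comm]
      rfl
  have hzero : ∀ i, quad (v + Φ) (x i + Δ i) = 0 := by
    intro i
    rw [quad_add, add_apply, quad_add_apply, quad_add_apply,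
      hbot _ (quad_mem_sq v (hΔI i)), hbot _ (quad_mem_sq Φ (hΔI i)),
      hbot _ (polar_quad_mem_sq hΦI (x i) (hΔI i))]
    linear_combination hlin i
  refine ⟨fun i l => x i l + Δ i l, fun i l => by simpa using hΔI i l,
    fun i => by simp only [hxJ, hΔJ, add_zero], fun c' => ?_⟩
  have hu : IsUnit ((v + Φ) m₁) := by
    rw [← IsNilpotent.isUnit_quotient_mk_iff (I := I) ⟨2, hI⟩, Pi.add_apply, map_add,
      Ideal.Quotient.eq_zero_iff_mem.2 (hΦI m₁), add_zero]
    exact hvm.map _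
  have h6 := minor_mem_of_vecMul_mem (L := ⊥) (x := fun i l => x i l + Δ i l) hu (fun i => by
    rw [← quad_eq_vecMul (v + Φ) (fun i l => x i l + Δ i l) i]
    exact hzero i) c'
  simpa using h6

end Sufficiency

/-! ### Arcs along which the minors do not all vanish -/

section Arc

variable {R : Type*} [CommRing R] {n : ℕ}

/-- The sum of the distinct coordinate vectors occurring in a quadratic monomial. -/
noncomputable def Mon.point (m : Mon 3 2) : Fin 4 → R :=
  if m.fst = m.snd then Pi.single m.fst 1 else Pi.single m.fst 1 + Pi.single m.snd 1

theorem Mon.exists_square (a : Fin 4) : ∃ m : Mon 3 2, m.fst = a ∧ m.snd = a := by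
  let m : Mon 3 2 := ⟨Finsupp.single a 1 + Finsupp.single a 1, by
    rw [Finset.mem_finsuppAntidiag]
    refine ⟨?_, Finset.subset_univ _⟩
    simp [Finset.sum_add_distrib, Finsupp.single_apply]⟩
  have h : Finsupp.single a 1 + Finsupp.single a 1 =
      Finsupp.single m.fst 1 + Finsupp.single m.snd 1 := m.eq_single_add_single
  refine ⟨m, ?_, ?_⟩
  · by_contra hne
    have := DFunLike.congr_fun h m.fst
    simp [Finsupp.single_apply, Ne.symm hne] at this
    omega
  · by_contra hne
    have := DFunLike.congr_fun h m.snd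
    simp [Finsupp.single_apply, Ne.symm hne] at this

/-- Quadrics are determined by their values at the points `Mon.point m`. -/
theorem eq_zero_of_quad_point_eq_zero (v : Mon 3 2 → R)
    (hv : ∀ m : Mon 3 2, quad v m.point = 0) : v = 0 := by
  have hsq : ∀ a : Fin 4, quad v (Pi.single a 1) = 0 := by
    intro a
    obtain ⟨m, rfl, h2⟩ := Mon.exists_square a
    have := hv m
    rwa [Mon.point, if_pos h2.symm] at this
  funext m
  have h := hv m
  by_cases hm : m.fst = m.snd
  · rw [Mon.point, if_pos hm, quad_single v m hm] at h
    exact h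
  · rw [Mon.point, if_neg hm, quad_add_apply, hsq, hsq, polar_quad_single_single v m hm] at h
    simpa using h

theorem minor_smul (u : Fin n → R) (x : Fin n → Fin 4 → R) (c : Mon 3 2 ↪ Fin n) :
    minor 3 2 n (fun i l => u i * x i l) c = (∏ m, u (c m) ^ 2) * minor 3 2 n x c := by
  rw [minor, minor, ← Matrix.det_mul_row]
  congr 1
  ext m m'
  simp only [multiVeronese, Matrix.submatrix_apply, Matrix.of_apply, id, mul_pow,
    Finset.prod_mul_distrib, Finset.prod_pow_eq_pow_sum, (Finset.mem_finsuppAntidiag.1 m.2).1]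

/-- The generic maximal minor does not vanish. -/
theorem minor_generic_ne_zero [IsDomain R] (c : Mon 3 2 ↪ Fin n) :
    minor 3 2 n (fun i l => (MvPolynomial.X (i, l) : MvPolynomial (Fin n × Fin 4) R)) c ≠ 0 := by
  intro h0
  -- Specialise to ten points contained in no nonzero quadric.
  let q : Fin n → Fin 4 → R := Function.extend c (fun m => m.point) 0
  have hq : ∀ m, q (c m) = m.point := fun m => c.injective.extend_apply _ _ m
  have h1 : minor 3 2 n q c = 0 := by
    have := congrArg (aeval (fun il : Fin n × Fin 4 => q il.1 il.2)) h0
    rw [map_zero, ← AlgHom.coe_toRingHom, map_minor] at this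
    simpa using this
  rw [minor] at h1
  obtain ⟨w, hw0, hw⟩ := Matrix.exists_vecMul_eq_zero_iff.2 h1
  refine hw0 (eq_zero_of_quad_point_eq_zero w fun m => ?_)
  rw [← hq, quad_eq_vecMul]
  exact congrFun hw m

variable {k : Type*} [Field k]

/-- Every configuration is the special point of an arc along which some minor is not
identically zero. -/
theorem exists_arc_minor_ne_zero (a : Fin n → Fin 4 → k) (J : Fin n → Fin 4)
    (haJ : ∀ i, a i (J i) = 1) (c : Mon 3 2 ↪ Fin n) :
    ∃ x : Fin n → Fin 4 → PowerSeries k, (∀ i, x i (J i) = 1) ∧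
      (∀ i l, PowerSeries.constantCoeff (x i l) = a i l) ∧ minor 3 2 n x c ≠ 0 := by
  -- The power series with a prescribed constant term form an infinite set even when `k` is finite,
  -- so a nonzero polynomial cannot vanish on a product of such sets.
  obtain ⟨z, hza, hz⟩ : ∃ z : Fin n → Fin 4 → PowerSeries k,
      (∀ i l, PowerSeries.constantCoeff (z i l) = a i l) ∧ minor 3 2 n z c ≠ 0 := by
    by_contra! hcon
    refine minor_generic_ne_zero (R := PowerSeries k) c ?_
    refine MvPolynomial.funext_set
      (fun il => {f : PowerSeries k | PowerSeries.constantCoeff f = a il.1 il.2}) ?_ ?_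
    · intro il
      refine Set.infinite_of_injective_forall_mem
        (f := fun N : ℕ => PowerSeries.C (a il.1 il.2) + PowerSeries.X ^ (N + 1)) ?_ ?_
      · intro N M h
        have h1 := congrArg (PowerSeries.coeff (N + 1)) (add_left_cancel h)
        simp only [PowerSeries.coeff_X_pow, if_true] at h1
        by_contra hne
        rw [if_neg (by omega)] at h1
        exact one_ne_zero h1
      · intro N
        simp
    · intro z hz
      rw [map_zero, map_minor]
      simp only [eval_X]
      exact hcon (fun i l => z (i, l)) fun i l => hz (i, l) (Set.mem_univ _)
  have hzJ : ∀ i, z i (J i) * (z i (J i))⁻¹ = 1 := fun i =>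
    PowerSeries.mul_inv_cancel _ (by rw [hza, haJ]; exact one_ne_zero)
  refine ⟨fun i l => (z i (J i))⁻¹ * z i l, fun i => (mul_comm _ _).trans (hzJ i), fun i l => ?_, ?_⟩
  · rw [map_mul, PowerSeries.constantCoeff_inv, hza, hza, haJ, inv_one, one_mul]
  · rw [minor_smul]
    refine mul_ne_zero (Finset.prod_ne_zero_iff.2 fun m _ => pow_ne_zero _ ?_) hz
    exact right_ne_zero_of_mul_eq_one (hzJ _)

end Arc

/-! ### Determinants with two rows in an ideal -/

section TwoRows

theorem prod_sub_prod_mem {ι R : Type*} [CommRing R] {s : Finset ι} {I : Ideal R} {f g : ι → R} (h : ∀ i, f i - g i ∈ I) :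
    ∏ i ∈ s, f i - ∏ i ∈ s, g i ∈ I := by
  rw [← Ideal.Quotient.eq, map_prod, map_prod]
  exact Finset.prod_congr rfl fun i _ => Ideal.Quotient.eq.2 (h i)

variable {ι R : Type*} [Fintype ι] [DecidableEq ι] [CommRing R]

/-- If two rows of each of two matrices have entries in an ideal `m`, then the difference of the
determinants lies in `m * K`, where `K` contains the entries of the difference. -/
theorem det_sub_det_mem {A B : Matrix ι ι R} {m K : Ideal R} {i₀ i₁ : ι} (hne : i₀ ≠ i₁)
    (hA : ∀ j, A i₁ j ∈ m) (hB : ∀ j, B i₀ j ∈ m)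
    (hAB : ∀ i j, A i j - B i j ∈ K) : A.det - B.det ∈ m * K := by
  rw [← Matrix.det_transpose A, ← Matrix.det_transpose B, Matrix.det_apply', Matrix.det_apply',
    ← Finset.sum_sub_distrib]
  refine Ideal.sum_mem _ fun σ _ => ?_
  rw [← mul_sub]
  refine Ideal.mul_mem_left _ _ ?_
  simp only [Matrix.transpose_apply]
  have h1 : i₁ ∈ (Finset.univ.erase i₀) := Finset.mem_erase.2 ⟨hne.symm, Finset.mem_univ _⟩
  rw [← Finset.mul_prod_erase _ (fun i => A i (σ i)) (Finset.mem_univ i₀),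
    ← Finset.mul_prod_erase _ (fun i => B i (σ i)) (Finset.mem_univ i₀)]
  set P := ∏ i ∈ Finset.univ.erase i₀, A i (σ i) with hP
  set Q := ∏ i ∈ Finset.univ.erase i₀, B i (σ i)
  have hPm : P ∈ m := by
    rw [hP, ← Finset.mul_prod_erase _ (fun i => A i (σ i)) h1]
    exact m.mul_mem_right _ (hA _)
  have hPQ : P - Q ∈ K := prod_sub_prod_mem fun i => hAB i (σ i)
  -- Each summand pairs a difference in `K` with a factor in `m`: `P` contains an entry of row `i₁`
  -- of `A`, and the other factor is an entry of row `i₀` of `B`.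
  have : A i₀ (σ i₀) * P - B i₀ (σ i₀) * Q =
      P * (A i₀ (σ i₀) - B i₀ (σ i₀)) + B i₀ (σ i₀) * (P - Q) := by ring
  rw [this]
  exact Ideal.add_mem _ (Ideal.mul_mem_mul hPm (hAB _ _)) (Ideal.mul_mem_mul (hB _) hPQ)

/-- Left multiplication of the Veronese matrix by `g` scales the maximal minors by a unit and turns
two rows into the values of the quadrics `v` and `w` at the points. -/
theorem exists_isUnit_rows {k : Type*} [Field k] {v w : ι → k} (h : LinearIndependent k ![v, w]) :
    ∃ (g : Matrix ι ι k) (i₀ i₁ : ι), i₀ ≠ i₁ ∧ g i₀ = v ∧ g i₁ = w ∧ IsUnit g := by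
  have hs : LinearIndepOn k id (Set.range ![v, w]) := h.linearIndepOn_id
  set b := Module.Basis.extend hs with hb
  have : Fintype (hs.extend (Set.subset_univ _)) := FiniteDimensional.fintypeBasisIndex b
  have hcard : Fintype.card ι = Fintype.card (hs.extend (Set.subset_univ _)) := by
    rw [← Module.finrank_eq_card_basis b, Module.finrank_fintype_fun_eq_card]
  let e := Fintype.equivOfCardEq hcard
  have hv : v ∈ hs.extend (Set.subset_univ _) := hs.subset_extend _ ⟨0, rfl⟩
  have hw : w ∈ hs.extend (Set.subset_univ _) := hs.subset_extend _ ⟨1, rfl⟩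
  refine ⟨Matrix.of fun i => b (e i), e.symm ⟨v, hv⟩, e.symm ⟨w, hw⟩, ?_, ?_, ?_, ?_⟩
  · intro heq
    have h1 := congrArg Subtype.val (e.symm.injective heq)
    have h2 : (0 : Fin 2) = 1 := h.injective h1
    exact absurd h2 (by decide)
  · funext j
    simp [hb]
  · funext j
    simp [hb]
  · rw [← Matrix.linearIndependent_rows_iff_isUnit]
    exact b.linearIndependent.comp e e.injective

end TwoRows

/-! ### Obstructions to smoothness along arcs -/

section Necessity

variable {k : Type*} [Field k] {n : ℕ}

/-- The residue map of the ring of formal power series, as a `k`-algebra homomorphism. -/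
noncomputable def residue (k : Type*) [Field k] : PowerSeries k →ₐ[k] k :=
  { (PowerSeries.constantCoeff : PowerSeries k →+* k) with
    commutes' := fun r => by
      rw [PowerSeries.algebraMap_apply]
      exact PowerSeries.constantCoeff_C r }

theorem residue_apply (f : PowerSeries k) : residue k f = PowerSeries.constantCoeff f := rfl

instance : IsLocalHom (residue k) :=
  ⟨fun _ ha => PowerSeries.isUnit_iff_constantCoeff.2 ha⟩

theorem ker_residue : RingHom.ker (residue k) = IsLocalRing.maximalIdeal (PowerSeries k) := by
  ext f
  rw [RingHom.mem_ker, IsLocalRing.mem_maximalIdeal, mem_nonunits_iff,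
    PowerSeries.isUnit_iff_constantCoeff, isUnit_iff_ne_zero, not_not]
  rfl

/-- At a smooth point there is only one quadric through the configuration. -/
theorem not_linearIndependent_of_isSmoothAt (hn : 10 ≤ n)
    {p : Fin n → Projectivization k (Fin (3 + 1) → k)} {hp : p ∈ X k 3 2 n}
    {J : Fin n → Fin (3 + 1)} {hJ : InChart p J} (hs : Algebra.IsSmoothAt k (pointIdeal p hp J hJ))
    {v w : Mon 3 2 → k} (hv : ∀ i, quad v (chartCoord p J i) = 0)
    (hw : ∀ i, quad w (chartCoord p J i) = 0) : ¬ LinearIndependent k ![v, w] := by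
  intro hvw
  obtain ⟨c₀⟩ : Nonempty (Mon 3 2 ↪ Fin n) := by
    rw [Function.Embedding.nonempty_iff_card_le, Mon.card, Fintype.card_fin]
    exact hn
  obtain ⟨x, hxJ, hxa, hx0⟩ := exists_arc_minor_ne_zero (chartCoord p J) J (chartCoord_self hJ) c₀
  set 𝔪 := IsLocalRing.maximalIdeal (PowerSeries k) with h𝔪
  have hmem : ∀ f : PowerSeries k, f ∈ 𝔪 ↔ PowerSeries.constantCoeff f = 0 := fun f => by
    rw [h𝔪, ← ker_residue]
    rfl
  set K : Ideal (PowerSeries k) := Ideal.span (Set.range (minor 3 2 n x)) with hK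
  have hxK : ∀ c, minor 3 2 n x c ∈ K := fun c => Ideal.subset_span ⟨c, rfl⟩
  have hKm : K ≤ 𝔪 := by
    rw [hK, Ideal.span_le]
    rintro _ ⟨c, rfl⟩
    rw [SetLike.mem_coe, hmem, map_minor]
    simp only [hxa]
    exact minor_chartCoord hp J c
  -- The arc lies on the scheme modulo `K`, and `K` modulo `𝔪 * K` has square zero, so smoothness
  -- yields `y` congruent to `x` modulo `K` with minors in `𝔪 * K`.
  obtain ⟨y, hyx, -, hy⟩ := exists_lift_mod_of_isSmoothAt hs (residue k) K (𝔪 * K)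
    (by rw [pow_two]; exact Ideal.mul_mono_left hKm) Ideal.mul_le_right
    (by rw [ker_residue]; exact (Ideal.mul_le_left : 𝔪 * K ≤ 𝔪)) x hxJ hxa hxK
  have hya : ∀ i l, PowerSeries.constantCoeff (y i l) = chartCoord p J i l := fun i l => by
    rw [← hxa, ← sub_eq_zero, ← map_sub]
    exact (hmem _).1 (hKm (hyx i l))
  obtain ⟨g, i₀, i₁, hne, hg0, hg1, hg⟩ := exists_isUnit_rows hvw
  set G : Matrix (Mon 3 2) (Mon 3 2) (PowerSeries k) := g.map PowerSeries.C with hG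
  have hGu : IsUnit G.det := by
    have := (Matrix.isUnit_iff_isUnit_det g).1 hg
    have h1 : G.det = PowerSeries.C g.det := by
      rw [RingHom.map_det]
      rfl
    rw [h1]
    exact this.map _
  have hrow : ∀ (z : Fin n → Fin 4 → PowerSeries k) (u : Mon 3 2 → k) (i : Mon 3 2), g i = u →
      (∀ i, quad u (chartCoord p J i) = 0) →
      (∀ i l, PowerSeries.constantCoeff (z i l) = chartCoord p J i l) →
      ∀ (c : Mon 3 2 ↪ Fin n) (j : Mon 3 2),
        (G * (multiVeronese 3 2 n z).submatrix id c) i j ∈ 𝔪 := by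
    intro z u i hgi hu hza c j
    have h1 : (G * (multiVeronese 3 2 n z).submatrix id c) i j =
        quad (PowerSeries.C ∘ u) (z (c j)) := by
      rw [quad_eq_vecMul, ← hgi]
      rfl
    rw [h1, hmem, map_quad]
    have h2 : PowerSeries.constantCoeff ∘ z (c j) = chartCoord p J (c j) := funext fun l => hza _ l
    have h3 : PowerSeries.constantCoeff ∘ PowerSeries.C ∘ u = u := funext fun m =>
      PowerSeries.constantCoeff_C _
    rw [h2, h3, hu]
  have hminor : ∀ c, minor 3 2 n x c ∈ 𝔪 * K := by
    intro c
    have h1 := det_sub_det_mem hne (hrow x w i₁ hg1 hw hxa c) (hrow y v i₀ hg0 hv hya c)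
      (K := K) (fun i j => by
        rw [Matrix.mul_apply, Matrix.mul_apply, ← Finset.sum_sub_distrib]
        refine K.sum_mem fun m _ => ?_
        rw [← mul_sub]
        refine K.mul_mem_left _ ?_
        have h2 : ∏ l, x (c j) l ^ m.1 l - ∏ l, y (c j) l ^ m.1 l ∈ K :=
          prod_sub_prod_mem fun l => by
            rw [← Ideal.Quotient.eq, map_pow, map_pow,
              Ideal.Quotient.eq.2 (neg_sub (y (c j) l) _ ▸ K.neg_mem (hyx (c j) l))]
        exact h2)
    rw [Matrix.det_mul, Matrix.det_mul, ← mul_sub] at h1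
    have h2 := (Ideal.unit_mul_mem_iff_mem _ hGu).1 h1
    have h3 := Ideal.add_mem _ h2 (hy c)
    rwa [show ((multiVeronese 3 2 n y).submatrix id c).det = minor 3 2 n y c from rfl,
      sub_add_cancel] at h3
  -- Nakayama: the generators of `K` lie in `𝔪 * K`.
  have hK0 : K = ⊥ := by
    refine Submodule.eq_bot_of_le_smul_of_le_jacobson_bot 𝔪 K (IsNoetherian.noetherian K) ?_
      (IsLocalRing.maximalIdeal_le_jacobson _)
    rw [smul_eq_mul, hK, Ideal.span_le]
    rintro _ ⟨c, rfl⟩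
    exact hminor c
  have := hxK c₀
  rw [hK0] at this
  exact hx0 (by simpa using this)

theorem exists_eq_add_X_smul {ι : Type*} (v : ι → PowerSeries k) (v₀ : ι → k)
    (h : ∀ m, PowerSeries.constantCoeff (v m) = v₀ m) :
    ∃ φ : ι → PowerSeries k, v = PowerSeries.C ∘ v₀ + (PowerSeries.X : PowerSeries k) • φ := by
  have h1 : ∀ m, ∃ f, v m - PowerSeries.C (v₀ m) = PowerSeries.X * f := fun m =>
    PowerSeries.X_dvd_iff.2 (by rw [map_sub, h, PowerSeries.constantCoeff_C, sub_self])
  choose φ hφ using h1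
  refine ⟨φ, funext fun m => ?_⟩
  simp [← hφ]

/-- Second order terms of an arc in the incidence variety: if the arc `(v, y)` is incident modulo
`t³` and its tangent vector moves only points that are singular on the central quadric, then,
at the singular points, `F(δ) + ψ(a) = 0`, where `δ` is the tangent vector. -/
theorem exists_second_order (a : Fin n → Fin 4 → k) (v₀ : Mon 3 2 → k)
    (ha : ∀ i, quad v₀ (a i) = 0)
    (huniq : ∀ w, (∀ i, quad w (a i) = 0) → ∃ c : k, w = c • v₀)
    (δ : Fin n → Fin 4 → k)
    (hδ : ∀ i, QuadraticMap.polar (quad v₀) (a i) (δ i) = 0)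
    (v : Mon 3 2 → PowerSeries k) (hv : ∀ m, PowerSeries.constantCoeff (v m) = v₀ m)
    (η : Fin n → Fin 4 → PowerSeries k)
    (hη : ∀ i l, PowerSeries.constantCoeff (η i l) = δ i l)
    (hinc : ∀ i, (PowerSeries.X : PowerSeries k) ^ 3 ∣ quad v (PowerSeries.C ∘ a i +
      (PowerSeries.X : PowerSeries k) • η i)) :
    ∃ ψ : Mon 3 2 → k, ∀ i, (∀ y, QuadraticMap.polar (quad v₀) (a i) y = 0) →
      quad v₀ (δ i) + quad ψ (a i) = 0 := by
  obtain ⟨φ, hφ⟩ := exists_eq_add_X_smul v v₀ hv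
  have hCa : ∀ i, quad (PowerSeries.C ∘ v₀) (PowerSeries.C ∘ a i) = 0 := fun i => by
    rw [← map_quad, ha, map_zero]
  have hctη : ∀ i, PowerSeries.constantCoeff ∘ η i = δ i := fun i => funext (hη i)
  have hctC : ∀ {ι : Type} (u : ι → k), PowerSeries.constantCoeff ∘ PowerSeries.C ∘ u = u :=
    fun u => funext fun m => PowerSeries.constantCoeff_C _
  have hcta : ∀ i, PowerSeries.constantCoeff ∘ (PowerSeries.C ∘ a i +
      (PowerSeries.X : PowerSeries k) • η i) = a i := fun i => by
    funext l
    simp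
  -- The coefficient of `t`: the polar term vanishes by `hδ`, so the first-order change of the
  -- quadric contains the configuration and is a multiple of `v₀`.
  have hφ0 : ∀ i, quad (PowerSeries.constantCoeff ∘ φ) (a i) = 0 := by
    intro i
    obtain ⟨r, hr⟩ := hinc i
    have h1 : (PowerSeries.X : PowerSeries k) * (QuadraticMap.polar (quad (PowerSeries.C ∘ v₀))
        (PowerSeries.C ∘ a i) (η i) + PowerSeries.X * quad (PowerSeries.C ∘ v₀) (η i) +
        quad φ (PowerSeries.C ∘ a i + (PowerSeries.X : PowerSeries k) • η i)) =
        PowerSeries.X * (PowerSeries.X ^ 2 * r) := by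
      rw [hφ, quad_add, add_apply, quad_add_apply, hCa, QuadraticMap.polar_smul_right, quad_smul,
        smul_apply, QuadraticMap.map_smul, smul_eq_mul, smul_eq_mul, smul_eq_mul] at hr
      linear_combination hr
    have h2 := congrArg PowerSeries.constantCoeff (mul_left_cancel₀ PowerSeries.X_ne_zero h1)
    rw [map_add, map_add, map_polar_quad, hctC, hctC, hctη, hδ, map_quad, hcta] at h2
    simpa using h2
  obtain ⟨c, hc⟩ := huniq _ hφ0
  obtain ⟨ψ, hψ⟩ := exists_eq_add_X_smul (φ - PowerSeries.C c • v) 0 (fun m => by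
    have := congrFun hc m
    simp only [Function.comp_apply, Pi.smul_apply, smul_eq_mul] at this
    simp [this, hv])
  -- Rescaling the quadric by `1 - c t` removes its first-order term.
  have hv' : (1 - PowerSeries.C c * PowerSeries.X) • v =
      PowerSeries.C ∘ v₀ + (PowerSeries.X ^ 2 : PowerSeries k) • ψ := by
    have h0 : (PowerSeries.C ∘ (0 : Mon 3 2 → k)) = 0 := by
      funext; simp
    rw [h0, zero_add] at hψ
    funext m
    have h1 := congrFun hφ m
    have h2 := congrFun hψ m
    simp only [Pi.add_apply, Pi.smul_apply, Pi.sub_apply, smul_eq_mul] at h1 h2 ⊢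
    linear_combination h1 + PowerSeries.X * h2
  refine ⟨PowerSeries.constantCoeff ∘ ψ, fun i hi => ?_⟩
  obtain ⟨r, hr⟩ := hinc i
  -- At a singular point the unknown second-order motion of the point contributes nothing, because
  -- it enters only through the polar form.
  have hpol : QuadraticMap.polar (quad (PowerSeries.C ∘ v₀)) (PowerSeries.C ∘ a i) (η i) = 0 := by
    rw [polar_eq_sum]
    refine Finset.sum_eq_zero fun l _ => ?_
    have h1 : (Pi.single l 1 : Fin 4 → PowerSeries k) = PowerSeries.C ∘ Pi.single l 1 := by
      funext l'
      simp [Pi.single_apply, apply_ite]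
    rw [h1, ← map_polar_quad, hi, map_zero, mul_zero]
  have h3 : (PowerSeries.X ^ 2 : PowerSeries k) * (quad (PowerSeries.C ∘ v₀) (η i) +
      quad ψ (PowerSeries.C ∘ a i + (PowerSeries.X : PowerSeries k) • η i)) =
      PowerSeries.X ^ 2 * ((1 - PowerSeries.C c * PowerSeries.X) * (PowerSeries.X * r)) := by
    have h4 : quad ((1 - PowerSeries.C c * PowerSeries.X) • v) (PowerSeries.C ∘ a i +
        (PowerSeries.X : PowerSeries k) • η i) =
        (1 - PowerSeries.C c * PowerSeries.X) * (PowerSeries.X ^ 3 * r) := by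
      rw [quad_smul, smul_apply, hr, smul_eq_mul]
    rw [hv', quad_add, add_apply, quad_add_apply, hCa, QuadraticMap.polar_smul_right, hpol,
      quad_smul, smul_apply, QuadraticMap.map_smul, smul_eq_mul, smul_eq_mul, smul_eq_mul] at h4
    linear_combination h4
  have h5 := congrArg PowerSeries.constantCoeff
    (mul_left_cancel₀ (pow_ne_zero 2 PowerSeries.X_ne_zero) h3)
  rw [map_add, map_quad, map_quad, hctC, hctη, hcta] at h5
  simpa using h5

/-- At a smooth point the singular points of the quadric among the points of the configuration
impose independent conditions on quadrics. -/
theorem eq_zero_of_isSmoothAt (hn : 10 ≤ n)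
    {p : Fin n → Projectivization k (Fin (3 + 1) → k)} {hp : p ∈ X k 3 2 n}
    {J : Fin n → Fin (3 + 1)} {hJ : InChart p J} (hs : Algebra.IsSmoothAt k (pointIdeal p hp J hJ))
    {v₀ : Mon 3 2 → k} (hv₀ : v₀ ≠ 0) (ha : ∀ i, quad v₀ (chartCoord p J i) = 0)
    (huniq : ∀ w, (∀ i, quad w (chartCoord p J i) = 0) → ∃ c : k, w = c • v₀)
    (e : Fin n → k)
    (hsing : ∀ i, e i ≠ 0 → ∀ y, QuadraticMap.polar (quad v₀) (chartCoord p J i) y = 0)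
    (he : ∀ φ, ∑ i, e i * quad φ (chartCoord p J i) = 0) : e = 0 := by
  by_contra hne
  obtain ⟨j, hj⟩ := Function.ne_iff.1 hne
  rw [Pi.zero_apply] at hj
  set a := chartCoord p J with hadef
  -- Subtracting a multiple of `a j` makes the direction tangent to the chart; the value of `v₀` is
  -- unchanged because `a j` is a singular point of the quadric.
  obtain ⟨δ₁, hδ₁, hδJ⟩ : ∃ δ₁, quad v₀ δ₁ ≠ 0 ∧ δ₁ (J j) = 0 := by
    obtain ⟨δ₀, hδ₀⟩ : ∃ δ₀, quad v₀ δ₀ ≠ 0 := by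
      by_contra! hcon
      refine hv₀ (quad_injective (QuadraticMap.ext fun x => ?_))
      rw [hcon, quad_apply]
      simp
    refine ⟨δ₀ - δ₀ (J j) • a j, ?_, ?_⟩
    · rw [sub_eq_add_neg, ← neg_smul, quad_add_apply, QuadraticMap.polar_smul_right,
        QuadraticMap.polar_comm, hsing j hj, QuadraticMap.map_smul, ha]
      simpa using hδ₀
    · simp [a, chartCoord_self hJ]
  set δ : Fin n → Fin 4 → k := Pi.single j δ₁ with hδ
  have hδ0 : ∀ i, QuadraticMap.polar (quad v₀) (a i) (δ i) = 0 := by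
    intro i
    by_cases hij : i = j
    · subst hij
      exact hsing i hj _
    · simp [hδ, hij]
  let x : Fin n → Fin 4 → PowerSeries k := fun i =>
    PowerSeries.C ∘ a i + (PowerSeries.X : PowerSeries k) • (PowerSeries.C ∘ δ i)
  have hxa : ∀ i l, residue k (x i l) = a i l := fun i l => by
    simp [x, residue_apply]
  have hCa : ∀ i, quad (PowerSeries.C ∘ v₀) (PowerSeries.C ∘ a i) = 0 := fun i => by
    rw [← map_quad, ha, map_zero]
  obtain ⟨m₀, hm₀⟩ := Function.ne_iff.1 hv₀
  rw [Pi.zero_apply] at hm₀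
  -- The constant quadric `v₀` contains the arc modulo `t ^ 2`. Lifting then passes to `t ^ 3`,
  -- where the obstruction first appears.
  have hxK : ∀ c, minor 3 2 n x c ∈ Ideal.span {(PowerSeries.X : PowerSeries k) ^ 2} := by
    refine minor_mem_of_vecMul_mem (v := PowerSeries.C ∘ v₀) (m := m₀)
      ((isUnit_iff_ne_zero.2 hm₀).map _) fun i => ?_
    rw [← quad_eq_vecMul, quad_add_apply, hCa, QuadraticMap.polar_smul_right, ← map_polar_quad,
      hδ0, map_zero, smul_zero, QuadraticMap.map_smul, zero_add, zero_add, smul_eq_mul, ← pow_two]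
    exact Ideal.mul_mem_right _ _ (Ideal.mem_span_singleton_self _)
  obtain ⟨y, hyx, -, hy⟩ := exists_lift_mod_of_isSmoothAt hs (residue k)
    (Ideal.span {(PowerSeries.X : PowerSeries k) ^ 2})
    (Ideal.span {(PowerSeries.X : PowerSeries k) ^ 3})
    (by
      rw [Ideal.span_singleton_pow, Ideal.span_singleton_le_span_singleton, ← pow_mul]
      exact pow_dvd_pow _ (by norm_num))
    (by
      rw [Ideal.span_singleton_le_span_singleton]
      exact pow_dvd_pow _ (by norm_num))
    (by
      rw [Ideal.span_singleton_le_iff_mem, RingHom.mem_ker, residue_apply]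
      simp)
    x (fun i => by
      by_cases hij : i = j
      · subst hij
        simp [x, hδ, hδJ, a, chartCoord_self hJ]
      · simp [x, hδ, hij, a, chartCoord_self hJ]) hxa hxK
  choose ζ hζ using fun i l => Ideal.mem_span_singleton.1 (hyx i l)
  let η : Fin n → Fin 4 → PowerSeries k := fun i =>
    PowerSeries.C ∘ δ i + (PowerSeries.X : PowerSeries k) • ζ i
  have hyη : ∀ i, y i = PowerSeries.C ∘ a i + (PowerSeries.X : PowerSeries k) • η i := by
    intro i
    funext l
    have := hζ i l
    simp only [x, η, Pi.add_apply, Pi.smul_apply, smul_eq_mul, Function.comp_apply] at this ⊢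
    linear_combination this
  obtain ⟨c, m₁, hcm⟩ := exists_embedding_adjugate_ne_zero (multiVeronese 3 2 n a)
    (by rw [Mon.card, Fintype.card_fin]; exact hn) v₀ m₀ hm₀
    (funext fun i => by rw [← quad_eq_vecMul]; exact ha i)
    (fun w hw => huniq w fun i => by rw [quad_eq_vecMul]; exact congrFun hw i)
  have hadj : ∀ i, quad (adjRow (r := 3) a c m₀) (a i) = 0 := fun i => by
    rw [quad_eq_vecMul]
    have := adjRow_vecMul_mem (L := ⊥) (x := a)
      (fun c => (Ideal.mem_bot).2 (minor_chartCoord hp J c)) c m₀ i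
    simpa using this
  -- By uniqueness the adjugate row at `a` is a nonzero multiple of `v₀`; dividing by `γ` makes the
  -- lifted quadric specialise to `v₀`.
  obtain ⟨γ, hγ⟩ := huniq _ hadj
  have hγ0 : γ ≠ 0 := by
    rintro rfl
    exact hcm (by simpa [adjRow] using congrFun hγ m₁)
  obtain ⟨ψ, hψ⟩ := exists_second_order a v₀ ha huniq δ hδ0
    (PowerSeries.C γ⁻¹ • adjRow (r := 3) y c m₀)
    (fun m => by
      have h1 := congrFun (map_adjRow (r := 3) PowerSeries.constantCoeff y c m₀) m
      have h2 : (fun i l => PowerSeries.constantCoeff (y i l)) = a := by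
        funext i l
        rw [hyη]
        simp
      rw [h2, hγ] at h1
      simp only [Function.comp_apply, Pi.smul_apply, smul_eq_mul] at h1
      simp [h1, hγ0]) η
    (fun i l => by simp [η])
    (fun i => by
      rw [← hyη, quad_smul, smul_apply, smul_eq_mul]
      refine Dvd.dvd.mul_left ?_ _
      rw [quad_eq_vecMul, ← Ideal.mem_span_singleton]
      exact adjRow_vecMul_mem hy c m₀ i)
  -- Pairing the second-order equations with `e` eliminates the unknown `ψ`; as only `δ j` is
  -- nonzero, `e j * quad v₀ δ₁ = 0` remains.
  have hsum : ∑ i, e i * quad v₀ (δ i) = 0 := by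
    have h1 : ∀ i, e i * quad v₀ (δ i) = - (e i * quad ψ (a i)) := by
      intro i
      by_cases hei : e i = 0
      · simp [hei]
      · linear_combination e i * hψ i (hsing i hei)
    simp only [h1, Finset.sum_neg_distrib, he, neg_zero]
  rw [Finset.sum_eq_single j] at hsum
  · rw [hδ, Pi.single_eq_same] at hsum
    exact mul_ne_zero hj hδ₁ hsum
  · intro i _ hij
    rw [hδ, Pi.single_eq_of_ne hij, QuadraticMap.map_zero, mul_zero]
  · simp

end Necessity

/-! ### Linear forms and their products -/

section LinearForms

variable {R : Type*} [CommRing R]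

/-- The linear form with the given coefficients. -/
noncomputable def linPoly (f : Fin 4 → R) : MvPolynomial (Fin 4) R :=
  ∑ j, C (f j) * MvPolynomial.X j

theorem isHomogeneous_linPoly (f : Fin 4 → R) : (linPoly f).IsHomogeneous 1 :=
  IsHomogeneous.sum _ _ _ fun j _ => by
    simpa using (isHomogeneous_C (Fin 4) (f j)).mul (isHomogeneous_X R j)

theorem aeval_linPoly {S : Type*} [CommRing S] [Algebra R S] (f : Fin 4 → R) (x : Fin 4 → S) :
    aeval x (linPoly f) = ∑ j, algebraMap R S (f j) * x j := by
  simp [linPoly]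

theorem aeval_linPoly_self (f : Fin 4 → R) (x : Fin 4 → R) :
    aeval x (linPoly f) = f ⬝ᵥ x := by
  simp [linPoly, dotProduct]

theorem pderiv_linPoly (f : Fin 4 → R) (j : Fin 4) : pderiv j (linPoly f) = C (f j) := by
  simp [linPoly, pderiv_X, Pi.single_apply]

theorem quad_quadCoeff {F : MvPolynomial (Fin 4) R} (hF : F.IsHomogeneous 2) (x : Fin 4 → R) :
    quad (quadCoeff F) x = aeval x F := by
  conv_rhs => rw [← quadPoly_quadCoeff hF, aeval_quadPoly]
  rfl

theorem polar_quadCoeff {F : MvPolynomial (Fin 4) R} (hF : F.IsHomogeneous 2) (x : Fin 4 → R)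
    (j : Fin 4) :
    QuadraticMap.polar (quad (quadCoeff F)) x (Pi.single j 1) = aeval x (pderiv j F) := by
  conv_rhs => rw [← quadPoly_quadCoeff hF, aeval_pderiv_quadPoly]
  rfl

theorem eq_of_aeval_eq {F G : MvPolynomial (Fin 4) R} (hF : F.IsHomogeneous 2)
    (hG : G.IsHomogeneous 2) (h : ∀ x : Fin 4 → R, aeval x F = aeval x G) : F = G := by
  rw [← quadPoly_quadCoeff hF, ← quadPoly_quadCoeff hG]
  congr 1
  refine quad_injective (QuadraticMap.ext fun x => ?_)
  rw [quad_quadCoeff hF, quad_quadCoeff hG, h]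

/-- The coefficients of the product of two linear forms. -/
noncomputable def linMul (f g : Fin 4 → R) : Mon 3 2 → R := quadCoeff (linPoly f * linPoly g)

theorem quad_linMul (f g x : Fin 4 → R) : quad (linMul f g) x = (f ⬝ᵥ x) * (g ⬝ᵥ x) := by
  rw [linMul, quad_quadCoeff ((isHomogeneous_linPoly f).mul (isHomogeneous_linPoly g)), map_mul,
    aeval_linPoly_self, aeval_linPoly_self]

end LinearForms

/-! ### Points imposing independent conditions on quadrics -/

section Independence

variable {k : Type*} [Field k] {n : ℕ}

/-- The points `a i`, `i ∈ T`, impose independent conditions on quadrics. -/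
def IndependentConditions (a : Fin n → Fin 4 → k) (T : Set (Fin n)) : Prop :=
  ∀ e : Fin n → k, (∀ i, e i ≠ 0 → i ∈ T) → (∀ φ, ∑ i, e i * quad φ (a i) = 0) → e = 0

open Classical in
theorem sum_extend_mul {R : Type*} [CommRing R] (T : Set (Fin n)) (g : T → R) (u : Fin n → R) :
    ∑ i, (if hi : i ∈ T then g ⟨i, hi⟩ else 0) * u i = ∑ i : T, g i * u i := by
  rw [← Fintype.sum_subtype_add_sum_subtype (· ∈ T)]
  have h : ∑ i : {x // x ∉ T}, (if hi : (i : Fin n) ∈ T then g ⟨i, hi⟩ else 0) * u i = 0 :=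
    Finset.sum_eq_zero fun i _ => by simp [i.2]
  rw [h, add_zero]
  refine Finset.sum_congr rfl fun i _ => ?_
  rw [dif_pos i.2]

/-- Duality: a functional vanishing on the image of the evaluation map is a relation among the
points, hence zero. -/
theorem IndependentConditions.exists_quad_eq {a : Fin n → Fin 4 → k} {T : Set (Fin n)}
    (h : IndependentConditions a T) (b : Fin n → k) : ∃ φ, ∀ i ∈ T, quad φ (a i) = b i := by
  classical
  let E : (Mon 3 2 → k) →ₗ[k] (T → k) :=
    { toFun := fun φ i => quad φ (a i)
      map_add' := fun φ ψ => by
        funext i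
        simp [quad_add]
      map_smul' := fun c φ => by
        funext i
        simp [quad_smul] }
  have hE : LinearMap.range E = ⊤ := by
    by_contra hlt
    obtain ⟨f, hf0, hf⟩ := Submodule.exists_le_ker_of_lt_top _ (lt_top_iff_ne_top.2 hlt)
    have hfx : ∀ x : T → k, f x = ∑ i, f (Pi.single i 1) * x i := by
      intro x
      conv_lhs => rw [pi_eq_sum_univ' x]
      simp [mul_comm]
    let e : Fin n → k := fun i => if hi : i ∈ T then f (Pi.single ⟨i, hi⟩ 1) else 0
    have he : e = 0 := h e (fun i hi => by
        by_contra hiT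
        exact hi (by simp [e, hiT])) (fun φ => by
        have h1 : f (E φ) = 0 := hf ⟨φ, rfl⟩
        rw [hfx] at h1
        rw [← h1]
        exact sum_extend_mul T (fun i => f (Pi.single i 1)) fun i => quad φ (a i))
    refine hf0 (LinearMap.ext fun x => ?_)
    rw [hfx, LinearMap.zero_apply]
    refine Finset.sum_eq_zero fun i _ => ?_
    have := congrFun he i
    simp only [e, i.2, dif_pos, Subtype.coe_eta, Pi.zero_apply] at this
    rw [this, zero_mul]
  obtain ⟨φ, hφ⟩ := LinearMap.range_eq_top.1 hE fun i => b i
  exact ⟨φ, fun i hi => congrFun hφ ⟨i, hi⟩⟩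

/-- Two representatives `s • b` and `t • b` of one projective point satisfy the relation with
coefficients `t ^ 2` and `-s ^ 2`. -/
theorem IndependentConditions.eq_of_smul_eq {a : Fin n → Fin 4 → k} {T : Set (Fin n)}
    (h : IndependentConditions a T) (ha : ∀ i, a i ≠ 0) {i j : Fin n} (hi : i ∈ T) (hj : j ∈ T)
    {b : Fin 4 → k} {s t : k} (hs : a i = s • b) (ht : a j = t • b) : i = j := by
  by_contra hij
  have h1 := h (Pi.single i (t ^ 2) - Pi.single j (s ^ 2)) (fun l hl => by
    by_cases hli : l = i
    · rwa [hli]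
    · by_cases hlj : l = j
      · rwa [hlj]
      · simp [hli, hlj] at hl) (fun φ => by
    simp only [Pi.sub_apply, sub_mul, Finset.sum_sub_distrib]
    rw [Finset.sum_eq_single i (fun l _ hl => by simp [hl]) (by simp),
      Finset.sum_eq_single j (fun l _ hl => by simp [hl]) (by simp), Pi.single_eq_same,
      Pi.single_eq_same, hs, ht, QuadraticMap.map_smul, QuadraticMap.map_smul, smul_eq_mul,
      smul_eq_mul]
    ring)
  have h2 := congrFun h1 j
  simp only [Pi.sub_apply, Pi.single_eq_same, Pi.zero_apply,
    Pi.single_eq_of_ne (Ne.symm hij)] at h2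
  have hs0 : s = 0 := by simpa using h2
  exact ha i (by rw [hs, hs0, zero_smul])

/-- Up to three distinct points impose independent conditions on quadrics. -/
theorem independentConditions_of_ncard_le_three {a : Fin n → Fin 4 → k} {T : Set (Fin n)}
    (ha : ∀ i, a i ≠ 0) (hT : T.ncard ≤ 3)
    (hinj : ∀ i ∈ T, ∀ j ∈ T, (∃ s : k, a i = s • a j) → i = j) :
    IndependentConditions a T := by
  classical
  intro e heT he
  by_contra hne
  obtain ⟨i, hi⟩ := Function.ne_iff.1 hne
  rw [Pi.zero_apply] at hi
  have hf : ∀ j, ∃ f : Fin 4 → k, f ⬝ᵥ a i ≠ 0 ∧ (j ∈ T → j ≠ i → f ⬝ᵥ a j = 0) := by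
    intro j
    by_cases hj : j ∈ T ∧ j ≠ i
    · obtain ⟨l, hl⟩ := Function.ne_iff.1 (ha j)
      rw [Pi.zero_apply] at hl
      by_contra! hcon
      refine hj.2 (hinj i (heT i hi) j hj.1 ⟨a i l / a j l, ?_⟩).symm
      funext m
      by_contra hm
      -- This 2 by 2 minor form vanishes at `a j`; if all such forms vanished at `a i`, the two
      -- points would be proportional.
      obtain ⟨-, -, h3⟩ := hcon (Pi.single m (a j l) - Pi.single l (a j m)) (by
        rw [sub_dotProduct, single_dotProduct, single_dotProduct]
        intro h
        refine hm ?_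
        rw [Pi.smul_apply, smul_eq_mul]
        field_simp
        linear_combination h)
      refine h3 ?_
      rw [sub_dotProduct, single_dotProduct, single_dotProduct]
      ring
    · obtain ⟨l, hl⟩ := Function.ne_iff.1 (ha i)
      exact ⟨Pi.single l 1, by simpa using hl, fun h1 h2 => absurd ⟨h1, h2⟩ hj⟩
  choose f hfi hfj using hf
  -- At most two other points remain. Missing ones are replaced by repetition or by `i`, which is
  -- harmless since every `f` is nonzero at `a i`.
  obtain ⟨x, y, hxy⟩ : ∃ x y, ∀ j ∈ T, j ≠ i → j = x ∨ j = y := by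
    have h1 : (T \ {i}).ncard ≤ 2 := by
      rw [Set.ncard_sdiff_singleton_of_mem (heT i hi)]
      omega
    have h2 : (T \ {i}).ncard = 0 ∨ (T \ {i}).ncard = 1 ∨ (T \ {i}).ncard = 2 := by omega
    rcases h2 with h2 | h2 | h2
    · rw [Set.ncard_eq_zero] at h2
      refine ⟨i, i, fun j hj hji => ?_⟩
      have : j ∈ T \ {i} := ⟨hj, hji⟩
      rw [h2] at this
      exact this.elim
    · obtain ⟨x, hx⟩ := Set.ncard_eq_one.1 h2
      refine ⟨x, x, fun j hj hji => ?_⟩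
      have : j ∈ T \ {i} := ⟨hj, hji⟩
      rw [hx] at this
      exact Or.inl this
    · obtain ⟨x, y, -, hx⟩ := Set.ncard_eq_two.1 h2
      refine ⟨x, y, fun j hj hji => ?_⟩
      have : j ∈ T \ {i} := ⟨hj, hji⟩
      rw [hx] at this
      exact this
  -- A pair of planes through the other points and missing `a i` isolates the coefficient `e i`.
  have h3 := he (linMul (f x) (f y))
  rw [Finset.sum_eq_single i] at h3
  · rw [quad_linMul] at h3
    exact mul_ne_zero hi (mul_ne_zero (hfi x) (hfi y)) h3
  · intro j _ hji
    by_cases hej : e j = 0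
    · rw [hej, zero_mul]
    · have hjT := heT j hej
      rw [quad_linMul]
      rcases hxy j hjT hji with rfl | rfl
      · rw [hfj j hjT hji]; ring
      · rw [hfj j hjT hji]; ring
  · simp

/-- At most three points on a line impose independent conditions on quadrics. -/
theorem IndependentConditions.ncard_le_three {a : Fin n → Fin 4 → k} {T : Set (Fin n)}
    (h : IndependentConditions a T) {b b' : Fin 4 → k} (s t : Fin n → k)
    (hst : ∀ i ∈ T, a i = s i • b + t i • b') : T.ncard ≤ 3 := by
  classical
  -- Quadrics restrict to binary quadratic forms on the line, so a relation among these vectors of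
  -- `k ^ 3` is a relation for all quadrics.
  have hli : LinearIndependent k
      (fun i : T => (![s i ^ 2, s i * t i, t i ^ 2] : Fin 3 → k)) := by
    rw [Fintype.linearIndependent_iff]
    intro g hg i
    let e : Fin n → k := fun i => if hi : i ∈ T then g ⟨i, hi⟩ else 0
    have hsum : ∀ u : Fin n → k, ∑ i, e i * u i = ∑ i : T, g i * u i := by
      exact fun u => sum_extend_mul T g u
    have he : e = 0 := h e (fun i hi => by
      by_contra hiT
      exact hi (by simp [e, hiT])) (fun φ => by
      rw [hsum]
      have h1 : ∀ i : T, g i * quad φ (a i) =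
          quad φ b * (g i * s i ^ 2) + QuadraticMap.polar (quad φ) b b' * (g i * (s i * t i)) +
            quad φ b' * (g i * t i ^ 2) := by
        intro i
        rw [hst i i.2, quad_add_apply, QuadraticMap.polar_smul_left, QuadraticMap.polar_smul_right,
          QuadraticMap.map_smul, QuadraticMap.map_smul]
        simp only [smul_eq_mul]
        ring
      have h2 := congrFun hg 0
      have h3 := congrFun hg 1
      have h4 := congrFun hg 2
      simp only [Finset.sum_apply, Pi.smul_apply, smul_eq_mul, Pi.zero_apply,
        Matrix.cons_val] at h2 h3 h4
      simp only [h1, Finset.sum_add_distrib, ← Finset.mul_sum, h2, h3, h4]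
      ring)
    have := congrFun he i
    simpa [e] using this
  have := hli.fintype_card_le_finrank
  rw [Module.finrank_fin_fun] at this
  rwa [← Nat.card_coe_set_eq, Nat.card_eq_fintype_card]

end Independence

/-! ### Diagonal quadrics and their rank -/

section Classification

variable {k : Type*} [Field k]

theorem exists_diagonalization (h2 : (2 : k) ≠ 0) (v : Mon 3 2 → k) :
    ∃ (W : Fin 4 → k) (Λ Λ' : Matrix (Fin 4) (Fin 4) k), Λ * Λ' = 1 ∧ Λ' * Λ = 1 ∧
      ∀ x, quad v x = ∑ i, W i * (Λ.mulVec x i) ^ 2 := by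
  have : Invertible (2 : k) := invertibleOfNonzero h2
  obtain ⟨w, ⟨f⟩⟩ := QuadraticForm.equivalent_weightedSumSquares (quad v)
  let e : Fin 4 ≃ Fin (Module.finrank k (Fin 4 → k)) := finCongr (Module.finrank_fin_fun k).symm
  let g : (Fin 4 → k) ≃ₗ[k] (Fin 4 → k) := f.toLinearEquiv.trans (LinearEquiv.funCongrLeft k k e)
  refine ⟨w ∘ e, LinearMap.toMatrix' g.toLinearMap, LinearMap.toMatrix' g.symm.toLinearMap,
    ?_, ?_, fun x => ?_⟩
  · rw [← LinearMap.toMatrix'_comp]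
    simp
  · rw [← LinearMap.toMatrix'_comp]
    simp
  · rw [LinearMap.toMatrix'_mulVec]
    have h1 := f.map_app x
    rw [← h1, QuadraticMap.weightedSumSquares_apply, ← e.sum_comp]
    refine Finset.sum_congr rfl fun i _ => ?_
    simp only [smul_eq_mul, Function.comp_apply, pow_two]
    rfl

/-- A quadratic form in diagonal form. -/
noncomputable def diagPoly (W : Fin 4 → k) (Λ : Matrix (Fin 4) (Fin 4) k) :
    MvPolynomial (Fin 4) k :=
  ∑ i, C (W i) * linPoly (Λ i) ^ 2

theorem isHomogeneous_diagPoly (W : Fin 4 → k) (Λ : Matrix (Fin 4) (Fin 4) k) :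
    (diagPoly W Λ).IsHomogeneous 2 :=
  IsHomogeneous.sum _ _ _ fun i _ => by
    simpa using (isHomogeneous_C (Fin 4) (W i)).mul ((isHomogeneous_linPoly (Λ i)).pow 2)

theorem aeval_diagPoly (W : Fin 4 → k) (Λ : Matrix (Fin 4) (Fin 4) k) (x : Fin 4 → k) :
    aeval x (diagPoly W Λ) = ∑ i, W i * (Λ.mulVec x i) ^ 2 := by
  simp only [diagPoly, map_sum, map_mul, map_pow, aeval_linPoly_self, aeval_C]
  rfl

variable {W : Fin 4 → k} {Λ Λ' : Matrix (Fin 4) (Fin 4) k}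

/-- Contracting the gradient with the dual basis, the columns of `Λ'`, gives `2 * W l` times the
`l`-th diagonal coordinate, so a zero of the gradient is the origin. -/
theorem isSmoothForm_diagPoly (h2 : (2 : k) ≠ 0) (hΛ : Λ * Λ' = 1) (hΛ' : Λ' * Λ = 1)
    (hW : ∀ i, W i ≠ 0) : IsSmoothForm (diagPoly W Λ) := by
  intro x hx0 _
  by_contra! hcon
  set f := algebraMap k (AlgebraicClosure k) with hf
  have hinj : Function.Injective f := FaithfulSMul.algebraMap_injective k (AlgebraicClosure k)
  have hd : ∀ j, ∑ i, f (2 * W i) * (Λ.map f).mulVec x i * f (Λ i j) = 0 := by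
    intro j
    rw [← hcon j]
    simp only [diagPoly, map_sum, Derivation.leibniz, Derivation.leibniz_pow, pderiv_C,
      pderiv_linPoly, smul_eq_mul, map_mul, map_pow, aeval_C, aeval_linPoly,
      mul_zero, add_zero, nsmul_eq_mul]
    refine Finset.sum_congr rfl fun i _ => ?_
    simp only [Matrix.mulVec, dotProduct, Matrix.map_apply, hf]
    push_cast
    simp only [map_ofNat]
    ring
  have hz : ∀ l, (Λ.map f).mulVec x l = 0 := by
    intro l
    have h1 : ∑ j, (∑ i, f (2 * W i) * (Λ.map f).mulVec x i * f (Λ i j)) * f (Λ' j l) = 0 :=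
      Finset.sum_eq_zero fun j _ => by rw [hd, zero_mul]
    have h3 : ∑ j, (∑ i, f (2 * W i) * (Λ.map f).mulVec x i * f (Λ i j)) * f (Λ' j l) =
        ∑ i, f (2 * W i) * (Λ.map f).mulVec x i * f ((Λ * Λ') i l) := by
      simp only [Finset.sum_mul, Matrix.mul_apply, map_sum, map_mul, Finset.mul_sum]
      rw [Finset.sum_comm]
      exact Finset.sum_congr rfl fun i _ => Finset.sum_congr rfl fun j _ => by ring
    rw [h3, hΛ, Finset.sum_eq_single l (fun i _ hi => by simp [Matrix.one_apply_ne hi])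
      (by simp), Matrix.one_apply_eq, map_one, mul_one] at h1
    rcases mul_eq_zero.1 h1 with h | h
    · exact absurd ((map_eq_zero_iff f hinj).1 h) (mul_ne_zero h2 (hW l))
    · exact h
  refine hx0 ?_
  have h4 : (Λ'.map f).mulVec ((Λ.map f).mulVec x) = x := by
    rw [Matrix.mulVec_mulVec, ← Matrix.map_mul, hΛ', Matrix.map_one _ (map_zero f) (map_one f),
      Matrix.one_mulVec]
  rw [← h4, funext hz]
  exact Matrix.mulVec_zero _

theorem dotProduct_col (hΛ : Λ * Λ' = 1) (i j : Fin 4) : Λ i ⬝ᵥ Λ'.col j = if i = j then 1 else 0 := by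
  rw [← Matrix.one_apply, ← hΛ]
  rfl

theorem isQuadricCone_diagPoly (h2 : (2 : k) ≠ 0) (hΛ : Λ * Λ' = 1) (i₀ : Fin 4)
    (h0 : W i₀ = 0) (hW : ∀ i, i ≠ i₀ → W i ≠ 0) : IsQuadricCone (diagPoly W Λ) := by
  have hinj : Function.Injective (algebraMap k (AlgebraicClosure k)) :=
    FaithfulSMul.algebraMap_injective k (AlgebraicClosure k)
  refine ⟨∑ a, C (W (i₀.succAbove a)) * MvPolynomial.X a ^ 2,
    fun a => linPoly (Λ (i₀.succAbove a)), ?_, ?_, fun a => isHomogeneous_linPoly _, ?_, ?_⟩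
  · refine IsHomogeneous.sum _ _ _ fun a _ => ?_
    simpa using (isHomogeneous_C (Fin 3) (W (i₀.succAbove a))).mul ((isHomogeneous_X k a).pow 2)
  · intro x hx0 _
    obtain ⟨j, hj⟩ := Function.ne_iff.1 hx0
    refine ⟨j, ?_⟩
    have h1 : aeval x (pderiv j (∑ a, C (W (i₀.succAbove a)) * MvPolynomial.X a ^ 2)) =
        algebraMap k (AlgebraicClosure k) (2 * W (i₀.succAbove j)) * x j := by
      simp only [map_sum, Derivation.leibniz, Derivation.leibniz_pow, pderiv_C, pderiv_X,
        smul_eq_mul, mul_zero, add_zero]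
      rw [Finset.sum_eq_single j (fun b _ hb => by simp [hb]) (by simp)]
      rw [map_mul (algebraMap _ _), map_ofNat]
      simp
      ring
    rw [h1]
    exact mul_ne_zero (fun h => mul_ne_zero h2 (hW _ (Fin.succAbove_ne _ _))
      ((map_eq_zero_iff _ hinj).1 h)) hj
  · rw [Fintype.linearIndependent_iff]
    intro g hg a
    have h1 := congrArg (aeval (Λ'.col (i₀.succAbove a))) hg
    simp only [map_sum, map_smul, aeval_linPoly_self, dotProduct_col hΛ, map_zero, smul_eq_mul,
      (Fin.succAbove_right_injective (p := i₀)).eq_iff] at h1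
    simpa using h1
  · simp only [diagPoly, map_sum, map_mul, map_pow, aeval_X, aeval_C]
    rw [Fin.sum_univ_succAbove _ i₀, h0]
    simp [algebraMap_eq]

/-- The form is `W j₀ * (ℓ₀ - r ℓ₁) * (ℓ₀ + r ℓ₁)`; the factors are independent because 2, `r` and
`W j₀` are nonzero. -/
theorem isTwoPlanes_diagPoly (h2 : (2 : k) ≠ 0) (hΛ : Λ * Λ' = 1) {j₀ j₁ : Fin 4} (hj : j₀ ≠ j₁)
    (hW : ∀ i, i ≠ j₀ → i ≠ j₁ → W i = 0) (hW0 : W j₀ ≠ 0) {r : k} (hr : r ≠ 0)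
    (hW1 : W j₁ = - W j₀ * r ^ 2) : IsTwoPlanes (diagPoly W Λ) := by
  have hsum : diagPoly W Λ = C (W j₀) * linPoly (Λ j₀) ^ 2 + C (W j₁) * linPoly (Λ j₁) ^ 2 := by
    rw [diagPoly]
    exact Fintype.sum_eq_add j₀ j₁ hj fun i hi => by rw [hW i hi.1 hi.2, C_0, zero_mul]
  have hl : ∀ s : k, (linPoly (Λ j₀) + C s * linPoly (Λ j₁)).IsHomogeneous 1 := fun s =>
    (isHomogeneous_linPoly _).add (by
      simpa using (isHomogeneous_C (Fin 4) s).mul (isHomogeneous_linPoly (Λ j₁)))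
  refine ⟨C (W j₀) * (linPoly (Λ j₀) + C (-r) * linPoly (Λ j₁)),
    linPoly (Λ j₀) + C r * linPoly (Λ j₁), ?_, hl r, ?_, ?_⟩
  · simpa using (isHomogeneous_C (Fin 4) (W j₀)).mul (hl (-r))
  · rw [LinearIndependent.pair_iff]
    intro s t hst
    have h0 := congrArg (aeval (Λ'.col j₀)) hst
    have h1 := congrArg (aeval (Λ'.col j₁)) hst
    simp only [map_add, map_smul, map_mul, aeval_linPoly_self, dotProduct_col hΛ, map_zero,
      smul_eq_mul, aeval_C, if_true, if_neg hj, if_neg hj.symm, Algebra.algebraMap_self,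
      RingHom.id_apply] at h0 h1
    have h3 : 2 * W j₀ * s * r = 0 := by linear_combination r * h0 - h1
    have hs : s = 0 := by simpa [h2, hW0, hr] using h3
    refine ⟨hs, ?_⟩
    rw [hs] at h0
    linear_combination h0
  · rw [hsum, hW1]
    simp only [map_neg, map_mul, map_pow]
    ring

theorem polar_diag {v : Mon 3 2 → k} (hv : ∀ x, quad v x = ∑ i, W i * (Λ.mulVec x i) ^ 2)
    (x y : Fin 4 → k) : QuadraticMap.polar (quad v) x y =
      ∑ i, 2 * W i * Λ.mulVec x i * Λ.mulVec y i := by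
  simp only [QuadraticMap.polar, hv, ← Finset.sum_sub_distrib, Matrix.mulVec_add, Pi.add_apply]
  exact Finset.sum_congr rfl fun i _ => by ring

theorem mulVec_eq_zero_of_polar_eq_zero (h2 : (2 : k) ≠ 0) (hΛ : Λ * Λ' = 1) {v : Mon 3 2 → k}
    (hv : ∀ x, quad v x = ∑ i, W i * (Λ.mulVec x i) ^ 2) {x : Fin 4 → k}
    (hx : ∀ y, QuadraticMap.polar (quad v) x y = 0) {i : Fin 4} (hi : W i ≠ 0) :
    Λ.mulVec x i = 0 := by
  have h1 := hx (Λ'.col i)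
  have h3 : ∀ j, Λ.mulVec (Λ'.col i) j = if j = i then 1 else 0 := fun j => dotProduct_col hΛ j i
  rw [polar_diag hv] at h1
  simpa [h3, h2, hi] using h1

theorem eq_sum_col (hΛ' : Λ' * Λ = 1) (x : Fin 4 → k) :
    x = ∑ i, Λ.mulVec x i • Λ'.col i := by
  conv_lhs => rw [← Matrix.one_mulVec x, ← hΛ', ← Matrix.mulVec_mulVec]
  funext l
  simp [Matrix.mulVec, dotProduct, mul_comm]

variable {n : ℕ}

/-- The unique quadric through a configuration does not contain the configuration in a
coordinate hyperplane of the diagonalisation. -/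
theorem exists_dotProduct_ne_zero {a : Fin n → Fin 4 → k} {v : Mon 3 2 → k}
    (huniq : ∀ w, (∀ i, quad w (a i) = 0) → ∃ c : k, w = c • v)
    (hΛ : Λ * Λ' = 1) {j₀ j₁ : Fin 4} (hj : j₀ ≠ j₁) : ∃ i, Λ j₀ ⬝ᵥ a i ≠ 0 := by
  by_contra! hcon
  -- If the hyperplane `ℓ₀ = 0` contained all points, then `ℓ₀ ^ 2` and `ℓ₀ * ℓ₁` would be multiples
  -- of one quadric; evaluation on the dual basis refutes this.
  obtain ⟨c, hc⟩ := huniq (linMul (Λ j₀) (Λ j₀)) fun i => by rw [quad_linMul, hcon, zero_mul]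
  obtain ⟨c', hc'⟩ := huniq (linMul (Λ j₀) (Λ j₁)) fun i => by rw [quad_linMul, hcon, zero_mul]
  have h1 := quad_linMul (Λ j₀) (Λ j₀) (Λ'.col j₀)
  have h3 := quad_linMul (Λ j₀) (Λ j₁) (Λ'.col j₀)
  have h4 := quad_linMul (Λ j₀) (Λ j₁) (Λ'.col j₀ + Λ'.col j₁)
  rw [hc, quad_smul, smul_apply, dotProduct_col hΛ, if_pos rfl, smul_eq_mul, mul_one] at h1
  rw [hc', quad_smul, smul_apply, dotProduct_col hΛ, dotProduct_col hΛ, if_neg hj.symm,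
    mul_zero, smul_eq_mul] at h3
  rw [hc', quad_smul, smul_apply, dotProduct_add, dotProduct_add, dotProduct_col hΛ,
    dotProduct_col hΛ, dotProduct_col hΛ, dotProduct_col hΛ, if_neg hj.symm, if_neg hj,
    if_pos rfl, if_pos rfl, smul_eq_mul] at h4
  have hc0 : c' = 0 := by
    rcases mul_eq_zero.1 h3 with h | h
    · exact h
    · rw [h, mul_zero] at h1
      exact absurd h1 zero_ne_one
  rw [hc0] at h4
  norm_num at h4

/-- Classification of the unique quadric through a configuration whose singular points impose
independent conditions. -/
theorem classification (h2 : (2 : k) ≠ 0) {F : MvPolynomial (Fin 4) k} (hF : F.IsHomogeneous 2)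
    (hF0 : F ≠ 0) {a : Fin n → Fin 4 → k} (ha0 : ∀ i, a i ≠ 0)
    (ha : ∀ i, quad (quadCoeff F) (a i) = 0)
    (huniq : ∀ w, (∀ i, quad w (a i) = 0) → ∃ c : k, w = c • quadCoeff F)
    (hind : IndependentConditions a
      {i | ∀ y, QuadraticMap.polar (quad (quadCoeff F)) (a i) y = 0}) :
    IsSmoothForm F ∨
      (IsQuadricCone F ∧
        {i | ∀ y, QuadraticMap.polar (quad (quadCoeff F)) (a i) y = 0}.ncard ≤ 1) ∨
      (IsTwoPlanes F ∧
        {i | ∀ y, QuadraticMap.polar (quad (quadCoeff F)) (a i) y = 0}.ncard ≤ 3) := by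
  obtain ⟨W, Λ, Λ', hΛ, hΛ', hW⟩ := exists_diagonalization h2 (quadCoeff F)
  have hFd : F = diagPoly W Λ := eq_of_aeval_eq hF (isHomogeneous_diagPoly W Λ) fun x => by
    rw [← quad_quadCoeff hF, hW, aeval_diagPoly]
  have hsing : ∀ i ∈ {i | ∀ y, QuadraticMap.polar (quad (quadCoeff F)) (a i) y = 0}, ∀ j,
      W j ≠ 0 → Λ.mulVec (a i) j = 0 := fun i hi j hj =>
    mulVec_eq_zero_of_polar_eq_zero h2 hΛ hW hi hj
  by_cases hall : ∀ i, W i ≠ 0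
  · left
    rw [hFd]
    exact isSmoothForm_diagPoly h2 hΛ hΛ' hall
  push Not at hall
  obtain ⟨i₀, hi₀⟩ := hall
  right
  by_cases hone : ∀ i, i ≠ i₀ → W i ≠ 0
  · left
    refine ⟨by rw [hFd]; exact isQuadricCone_diagPoly h2 hΛ i₀ hi₀ hone, ?_⟩
    have hline : ∀ i ∈ {i | ∀ y, QuadraticMap.polar (quad (quadCoeff F)) (a i) y = 0},
        a i = Λ.mulVec (a i) i₀ • Λ'.col i₀ := by
      intro i hi
      conv_lhs => rw [eq_sum_col hΛ' (a i)]
      exact Finset.sum_eq_single i₀ (fun j _ hj => by rw [hsing i hi j (hone j hj), zero_smul])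
        (by simp)
    rw [Set.ncard_le_one]
    exact fun i hi j hj => hind.eq_of_smul_eq ha0 hi hj (hline i hi) (hline j hj)
  push Not at hone
  obtain ⟨i₁, hne, hi₁⟩ := hone
  right
  obtain ⟨j₀, j₁, hj, hcover⟩ : ∃ j₀ j₁ : Fin 4, j₀ ≠ j₁ ∧
      ∀ i, i = j₀ ∨ i = j₁ ∨ i = i₀ ∨ i = i₁ := by
    clear hi₀ hi₁
    revert i₀ i₁
    decide
  have hWz : ∀ i, i ≠ j₀ → i ≠ j₁ → W i = 0 := by
    intro i h0 h1
    rcases hcover i with h | h | h | h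
    · exact absurd h h0
    · exact absurd h h1
    · rw [h, hi₀]
    · rw [h, hi₁]
  have hQ : ∀ x, quad (quadCoeff F) x =
      W j₀ * (Λ.mulVec x j₀) ^ 2 + W j₁ * (Λ.mulVec x j₁) ^ 2 := by
    intro x
    rw [hW]
    exact Fintype.sum_eq_add j₀ j₁ hj fun i hi => by rw [hWz i hi.1 hi.2, zero_mul]
  have hW01 : ¬ (W j₀ = 0 ∧ W j₁ = 0) := by
    rintro ⟨h0, h1⟩
    refine hF0 ?_
    rw [hFd, diagPoly]
    refine Finset.sum_eq_zero fun i _ => ?_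
    have : W i = 0 := by
      by_cases hij : i = j₀
      · rw [hij, h0]
      · by_cases hij' : i = j₁
        · rw [hij', h1]
        · exact hWz i hij hij'
    rw [this, C_0, zero_mul]
  -- Points off both coordinate hyperplanes exclude rank one. The incidence equation at `a i` then
  -- shows that `-W j₁ / W j₀` is a square in `k`, so the planes are rational.
  obtain ⟨i, hi⟩ := exists_dotProduct_ne_zero huniq hΛ hj
  obtain ⟨i', hi'⟩ := exists_dotProduct_ne_zero huniq hΛ hj.symm
  change Λ.mulVec (a i) j₀ ≠ 0 at hi
  change Λ.mulVec (a i') j₁ ≠ 0 at hi'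
  have e1 := (hQ (a i)).symm.trans (ha i)
  have e2 := (hQ (a i')).symm.trans (ha i')
  have hW1 : W j₁ ≠ 0 := by
    intro h
    refine hW01 ⟨?_, h⟩
    rw [h, zero_mul, add_zero] at e1
    exact (mul_eq_zero.1 e1).resolve_right (pow_ne_zero 2 hi)
  have hW0 : W j₀ ≠ 0 := by
    intro h
    refine hW1 ?_
    rw [h, zero_mul, zero_add] at e2
    exact (mul_eq_zero.1 e2).resolve_right (pow_ne_zero 2 hi')
  have ht : Λ.mulVec (a i) j₁ ≠ 0 := by
    intro h
    rw [h] at e1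
    exact mul_ne_zero hW0 (pow_ne_zero 2 hi) (by linear_combination e1)
  refine ⟨?_, ?_⟩
  · rw [hFd]
    refine isTwoPlanes_diagPoly h2 hΛ hj hWz hW0 (div_ne_zero hi ht) ?_
    field_simp
    linear_combination e1
  · have hi₀j₀ : i₀ ≠ j₀ := fun h => hW0 (h ▸ hi₀)
    have hi₁j₀ : i₁ ≠ j₀ := fun h => hW0 (h ▸ hi₁)
    refine hind.ncard_le_three (b := Λ'.col i₀) (b' := Λ'.col i₁)
      (fun i => Λ.mulVec (a i) i₀) (fun i => Λ.mulVec (a i) i₁) fun i hi => ?_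
    conv_lhs => rw [eq_sum_col hΛ' (a i)]
    refine Fintype.sum_eq_add i₀ i₁ hne.symm fun j hj' => ?_
    rcases hcover j with h | h | h | h
    · rw [h, hsing i hi j₀ hW0, zero_smul]
    · rw [h, hsing i hi j₁ hW1, zero_smul]
    · exact absurd h hj'.1
    · exact absurd h hj'.2

end Classification

/-! ### From projective quadrics and points to coordinates -/

section Hypersurfaces

variable {k : Type*} [Field k] {n : ℕ}

theorem Hypersurface.isHomogeneous_form {r d : ℕ} (S : Hypersurface k r d) :
    S.form.IsHomogeneous d :=
  (mem_homogeneousSubmodule _ _).1 S.rep.2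

theorem Hypersurface.form_ne_zero {r d : ℕ} (S : Hypersurface k r d) : S.form ≠ 0 :=
  fun h => S.rep_nonzero (Subtype.ext h)

theorem Hypersurface.eq_of_form_eq_smul {r d : ℕ} {S S' : Hypersurface k r d} {c : k}
    (h : S'.form = c • S.form) : S' = S := by
  rw [← S.mk_rep, ← S'.mk_rep, Projectivization.mk_eq_mk_iff']
  exact ⟨c, Subtype.ext h.symm⟩

theorem Hypersurface.quadCoeff_form_ne_zero (S : Hypersurface k 3 2) : quadCoeff S.form ≠ 0 := by
  intro h
  refine S.form_ne_zero ?_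
  rw [← quadPoly_quadCoeff S.isHomogeneous_form, h]
  simp [quadPoly]

theorem exists_hypersurface {w : Mon 3 2 → k} (hw : w ≠ 0) :
    ∃ (S : Hypersurface k 3 2) (c : k), c ≠ 0 ∧ quadCoeff S.form = c • w := by
  let F : homogeneousSubmodule (Fin (3 + 1)) k 2 :=
    ⟨quadPoly w, (mem_homogeneousSubmodule _ _).2 (isHomogeneous_quadPoly w)⟩
  have hF : F ≠ 0 := by
    intro h
    refine hw ?_
    have h1 : quadPoly w = 0 := congrArg Subtype.val h
    rw [← quadCoeff_quadPoly w, h1]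
    funext m
    simp [quadCoeff]
  obtain ⟨c, hc⟩ := Projectivization.exists_smul_eq_mk_rep k F hF
  refine ⟨Projectivization.mk k F hF, c, c.ne_zero, ?_⟩
  have h1 : Hypersurface.form (Projectivization.mk k F hF) = (c : k) • quadPoly w :=
    (congrArg Subtype.val hc).symm
  rw [h1]
  conv_rhs => rw [← quadCoeff_quadPoly w]
  funext m
  simp [quadCoeff]

variable {p : Fin n → Projectivization k (Fin (3 + 1) → k)} {J : Fin n → Fin (3 + 1)}

theorem chartCoord_eq_smul (i : Fin n) :
    chartCoord p J i = ((p i).rep (J i))⁻¹ • (p i).rep := by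
  funext l
  simp [chartCoord, div_eq_inv_mul]

theorem chartCoord_ne_zero (hJ : InChart p J) (i : Fin n) : chartCoord p J i ≠ 0 := by
  rw [chartCoord_eq_smul]
  exact smul_ne_zero (inv_ne_zero (hJ i)) (p i).rep_nonzero

theorem eq_iff_exists_chartCoord_eq_smul (hJ : InChart p J) (i j : Fin n) :
    p i = p j ↔ ∃ s : k, chartCoord p J i = s • chartCoord p J j := by
  have h1 : ∀ i, p i = Projectivization.mk k (chartCoord p J i) (chartCoord_ne_zero hJ i) := by
    intro i
    conv_lhs => rw [← (p i).mk_rep]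
    rw [Projectivization.mk_eq_mk_iff']
    exact ⟨(p i).rep (J i), by rw [chartCoord_eq_smul, smul_inv_smul₀ (hJ i)]⟩
  rw [h1 i, h1 j, Projectivization.mk_eq_mk_iff']
  exact exists_congr fun s => eq_comm

theorem contains_iff_quad_chartCoord (S : Hypersurface k 3 2) (hJ : InChart p J) (i : Fin n) :
    S.Contains (p i) ↔ quad (quadCoeff S.form) (chartCoord p J i) = 0 := by
  rw [chartCoord_eq_smul, QuadraticMap.map_smul, smul_eq_zero_iff_right
    (mul_ne_zero (inv_ne_zero (hJ i)) (inv_ne_zero (hJ i))),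
    quad_quadCoeff S.isHomogeneous_form]
  rfl

theorem isSingularAt_iff_polar_chartCoord (S : Hypersurface k 3 2) (hJ : InChart p J) {i : Fin n}
    (hi : S.Contains (p i)) : S.IsSingularAt (p i) ↔
      ∀ y, QuadraticMap.polar (quad (quadCoeff S.form)) (chartCoord p J i) y = 0 := by
  have h1 : ∀ y, QuadraticMap.polar (quad (quadCoeff S.form)) (chartCoord p J i) y = 0 ↔
      QuadraticMap.polar (quad (quadCoeff S.form)) (p i).rep y = 0 := fun y => by
    rw [chartCoord_eq_smul, QuadraticMap.polar_smul_left,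
      smul_eq_zero_iff_right (inv_ne_zero (hJ i))]
  simp only [h1]
  constructor
  · rintro ⟨-, h⟩ y
    rw [polar_eq_sum]
    refine Finset.sum_eq_zero fun l _ => ?_
    rw [polar_quadCoeff S.isHomogeneous_form]
    exact mul_eq_zero_of_right _ (h l)
  · exact fun h => ⟨hi, fun j =>
      (polar_quadCoeff S.isHomogeneous_form (p i).rep j).symm.trans (h _)⟩

/-- Independence of the conditions imposed by the singular points gives smoothness. -/
theorem isSmoothAt_of_independentConditions (hn : 10 ≤ n) {hp : p ∈ X k 3 2 n} {hJ : InChart p J}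
    {v : Mon 3 2 → k} (hv : v ≠ 0) (ha : ∀ i, quad v (chartCoord p J i) = 0)
    (huniq : ∀ w, (∀ i, quad w (chartCoord p J i) = 0) → ∃ c : k, w = c • v)
    (hind : IndependentConditions (chartCoord p J)
      {i | ∀ y, QuadraticMap.polar (quad v) (chartCoord p J i) y = 0}) :
    Algebra.IsSmoothAt k (pointIdeal p hp J hJ) := by
  obtain ⟨m₀, hm₀⟩ := Function.ne_iff.1 hv
  rw [Pi.zero_apply] at hm₀
  obtain ⟨c, m₁, hcm⟩ := exists_embedding_adjugate_ne_zero (multiVeronese 3 2 n (chartCoord p J))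
    (by rw [Mon.card, Fintype.card_fin]; exact hn) v m₀ hm₀
    (funext fun i => by rw [← quad_eq_vecMul]; exact ha i)
    (fun w hw => huniq w fun i => by rw [quad_eq_vecMul]; exact congrFun hw i)
  refine isSmoothAt_of_jacobian c m₀ m₁ hcm fun j => ?_
  obtain ⟨γ, hγ⟩ := huniq (adjRow (r := 3) (chartCoord p J) c m₀) fun i => by
    rw [quad_eq_vecMul]
    have := adjRow_vecMul_mem (L := ⊥) (x := chartCoord p J)
      (fun c => (Ideal.mem_bot).2 (minor_chartCoord hp J c)) c m₀ i
    simpa using this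
  have hγ0 : γ ≠ 0 := by
    rintro rfl
    exact hcm (by simpa [adjRow] using congrFun hγ m₁)
  have hpolar : ∀ x y, QuadraticMap.polar (quad (γ • v)) x y =
      γ * QuadraticMap.polar (quad v) x y := fun x y => by
    simp only [polar_quad, Finset.mul_sum, Pi.smul_apply, smul_eq_mul, mul_assoc]
  -- One quadric `φ` handles all singular points at once; each remaining equation is then solved by
  -- moving its own point.
  obtain ⟨φ, hφ⟩ := hind.exists_quad_eq fun i => if i = j then 1 else 0
  have hδ : ∀ i, ∃ δ : Fin 4 → k, δ (J i) = 0 ∧ quad φ (chartCoord p J i) +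
      QuadraticMap.polar (quad (γ • v)) (chartCoord p J i) δ = if i = j then 1 else 0 := by
    intro i
    by_cases hi : ∀ y, QuadraticMap.polar (quad v) (chartCoord p J i) y = 0
    · exact ⟨0, rfl, by rw [QuadraticMap.polar_zero_right, add_zero]; exact hφ i hi⟩
    · push Not at hi
      obtain ⟨y, hy⟩ := hi
      set s := QuadraticMap.polar (quad v) (chartCoord p J i) y with hs
      set b := (if i = j then (1 : k) else 0) - quad φ (chartCoord p J i) with hb
      -- Correcting `y` by a multiple of `a i` keeps the direction in the chart and leaves the polar
      -- value unchanged, since the polar form at `(a i, a i)` is `2 F(a i) = 0`.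
      refine ⟨(b / (γ * s)) • (y - y (J i) • chartCoord p J i), ?_, ?_⟩
      · simp [chartCoord_self hJ]
      · rw [hpolar, QuadraticMap.polar_smul_right, QuadraticMap.polar_sub_right,
          QuadraticMap.polar_smul_right, QuadraticMap.polar_self, ha, ← hs, smul_zero, smul_zero,
          sub_zero, smul_eq_mul]
        field_simp
        rw [hb]
        ring
  choose δ hδJ hδ using hδ
  exact ⟨φ, δ, hδJ, fun i => by rw [hγ]; exact hδ i⟩

theorem not_isSingularAt_of_isSmoothForm {S : Hypersurface k 3 2} (hS : IsSmoothForm S.form)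
    (x : Projectivization k (Fin (3 + 1) → k)) : ¬ S.IsSingularAt x := by
  rintro ⟨h0, hd⟩
  set f := algebraMap k (AlgebraicClosure k)
  have hinj : Function.Injective f := FaithfulSMul.algebraMap_injective k (AlgebraicClosure k)
  have haeval : ∀ F : MvPolynomial (Fin (3 + 1)) k, aeval (f ∘ x.rep) F = f (eval x.rep F) :=
    fun F => aeval_algebraMap_apply (AlgebraicClosure k) x.rep F
  obtain ⟨j, hj⟩ := hS (f ∘ x.rep) (fun h => x.rep_nonzero (funext fun l =>
    (map_eq_zero_iff f hinj).1 (congrFun h l))) (by rw [haeval, h0, map_zero])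
  exact hj (by rw [haeval, hd, map_zero])

end Hypersurfaces

end PointConfig

/-! ### The characterisation of smooth points -/

open PointConfig in
theorem theorem5p4 {k : Type*} [Field k] (hchar : ringChar k ≠ 2) (n : ℕ) (hn : 10 ≤ n)
    (p : Fin n → Projectivization k (Fin (3 + 1) → k)) (hp : p ∈ PointConfig.X k 3 2 n) :
    PointConfig.IsSmoothPoint p hp ↔
      ∃ S : PointConfig.Hypersurface k 3 2,
        ((∀ i, S.Contains (p i)) ∧
          ∀ S' : PointConfig.Hypersurface k 3 2, (∀ i, S'.Contains (p i)) → S' = S) ∧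
        (PointConfig.IsSmoothForm S.form ∨
          (PointConfig.IsQuadricCone S.form ∧
            {i | S.IsSingularAt (p i)}.ncard ≤ 1) ∨
          (PointConfig.IsTwoPlanes S.form ∧
            {i | S.IsSingularAt (p i)}.ncard ≤ 3 ∧
            Set.InjOn p {i | S.IsSingularAt (p i)})) := by
  have h2 : (2 : k) ≠ 0 := Ring.two_ne_zero hchar
  have hset : ∀ (S : Hypersurface k 3 2) (J : Fin n → Fin (3 + 1)), InChart p J →
      (∀ i, S.Contains (p i)) → {i | S.IsSingularAt (p i)} =
      {i | ∀ y, QuadraticMap.polar (quad (quadCoeff S.form)) (chartCoord p J i) y = 0} :=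
    fun S J hJ hS => Set.ext fun i => isSingularAt_iff_polar_chartCoord S hJ (hS i)
  constructor
  · intro hsm
    have hchart : ∀ i, ∃ l, (p i).rep l ≠ 0 := fun i => Function.ne_iff.1 (p i).rep_nonzero
    choose J hJ using hchart
    have hs := hsm J hJ
    obtain ⟨S, hS⟩ := id hp
    have ha := fun i => (contains_iff_quad_chartCoord S hJ i).1 (hS i)
    have huniq : ∀ w, (∀ i, quad w (chartCoord p J i) = 0) →
        ∃ c : k, w = c • quadCoeff S.form := by
      intro w hw
      have h := not_linearIndependent_of_isSmoothAt hn hs ha hw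
      rw [LinearIndependent.pair_iff' S.quadCoeff_form_ne_zero] at h
      push Not at h
      obtain ⟨c, hc⟩ := h
      exact ⟨c, hc.symm⟩
    have hind : IndependentConditions (chartCoord p J)
        {i | ∀ y, QuadraticMap.polar (quad (quadCoeff S.form)) (chartCoord p J i) y = 0} :=
      fun e he => eq_zero_of_isSmoothAt hn hs S.quadCoeff_form_ne_zero ha huniq e he
    refine ⟨S, ⟨hS, fun S' hS' => ?_⟩, ?_⟩
    · obtain ⟨c, hc⟩ := huniq _ fun i => (contains_iff_quad_chartCoord S' hJ i).1 (hS' i)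
      refine Hypersurface.eq_of_form_eq_smul (c := c) ?_
      rw [← quadPoly_quadCoeff S'.isHomogeneous_form, hc]
      conv_rhs => rw [← quadPoly_quadCoeff S.isHomogeneous_form]
      simp [quadPoly, Finset.smul_sum, MvPolynomial.smul_monomial]
    · rw [hset S J hJ hS]
      rcases classification h2 S.isHomogeneous_form S.form_ne_zero (chartCoord_ne_zero hJ) ha huniq
        hind with h | h | ⟨h, h'⟩
      · exact Or.inl h
      · exact Or.inr (Or.inl h)
      · refine Or.inr (Or.inr ⟨h, h', fun i hi j hj hij => ?_⟩)
        obtain ⟨s, hs⟩ := (eq_iff_exists_chartCoord_eq_smul hJ i j).1 hij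
        exact hind.eq_of_smul_eq (chartCoord_ne_zero hJ) hi hj hs (one_smul k _).symm
  · rintro ⟨S, ⟨hS, hSu⟩, hcases⟩ J hJ
    have ha := fun i => (contains_iff_quad_chartCoord S hJ i).1 (hS i)
    refine isSmoothAt_of_independentConditions hn S.quadCoeff_form_ne_zero ha ?_ ?_
    · intro w hw
      by_cases hw0 : w = 0
      · exact ⟨0, by rw [hw0, zero_smul]⟩
      · obtain ⟨S', c, hc, hcw⟩ := exists_hypersurface hw0
        obtain rfl := hSu S' fun i => (contains_iff_quad_chartCoord S' hJ i).2 (by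
          rw [hcw, quad_smul, smul_apply, hw i, smul_zero])
        exact ⟨c⁻¹, by rw [hcw, inv_smul_smul₀ hc]⟩
    · rw [← hset S J hJ hS]
      -- All three cases reduce to the same condition: no singular points on a smooth quadric, at
      -- most one on a cone, and at most three distinct ones on two planes.
      have hthree : {i | S.IsSingularAt (p i)}.ncard ≤ 3 ∧
          Set.InjOn p {i | S.IsSingularAt (p i)} := by
        rcases hcases with h | ⟨-, h⟩ | ⟨-, h⟩
        · have : {i | S.IsSingularAt (p i)} = ∅ :=
            Set.eq_empty_of_forall_notMem fun i => not_isSingularAt_of_isSmoothForm h (p i)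
          rw [this]
          simp
        · refine ⟨by omega, fun i hi j hj _ => ?_⟩
          exact (Set.ncard_le_one (Set.toFinite _)).1 h i hi j hj
        · exact h
      exact independentConditions_of_ncard_le_three (chartCoord_ne_zero hJ) hthree.1
        fun i hi j hj hij => hthree.2 hi hj ((eq_iff_exists_chartCoord_eq_smul hJ i j).2 hij)
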